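/- Let $\mathcal P$ be a finite polysquare translation surface, that is, a surface obtained from finitely many ($s$) unit squares by gluing, through translations, the right edge of each square to the left edge of exactly one square and the top edge of each square to the bottom edge of exactly one square. Its singular points are the vertices of cone angle greater than $2\pi$. Let $\mathcal M=\mathcal P\times[0,1)$ be the Cartesian product of $\mathcal P$ with the unit torus $[0,1)$ (a circle); it is made of $s$ unit cubes, and its singular points are those above the singular points of $\mathcal P$. A half-infinite sequence with step vector $\mathbf u$ on $\mathcal P$ (where $\mathbf u\in\mathbb R^2$) or in $\mathcal M$ (where $\mathbf u\in\mathbb R^3$) is a sequence $L(j)$, $j=0,1,2,\ldots$, where $L(t)$, $t\ge0$, is a half-infinite geodesic with constant velocity vector $\mathbf u$ that meets no singular point. It is called a Kronecker sequence if $\mathbf u$ is a Kronecker vector, that is, if the coordinates of $\mathbf u$ together with $1$ are linearly independent over $\mathbb Q$. Such a sequence is uniformly distributed if, for every convex set $S$ contained in one of the $s$ squares (respectively cubes), $$\lim_{J\to\infty}\frac1J\,\bigl|\{0\le j<J: L(j)\in S\}\bigr|=\frac{\lambda(S)}{s},$$ where $\lambda$ is the Lebesgue measure of dimension $2$ (respectively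 $3$). Theorem. Let $\mathbf v\in\mathbb R^2$ be a Kronecker vector. Then the following two statements are equivalent. (i) Every half-infinite Kronecker sequence with step vector $\mathbf v$ on $\mathcal P$ is uniformly distributed. (ii) For every $w\in\mathbb R$ such that $(\mathbf v,w)\in\mathbb R^3$ is a Kronecker vector, every half-infinite Kronecker sequence with step vector $(\mathbf v,w)$ in $\mathcal M$ is uniformly distributed. -/

import Mathlib

open Filter Topology MeasureTheory
open scoped NNReal

/-- A polysquare translation surface with atomic squares indexed by `σ` (finite when `σ` is finite):
unit squares glued along their edges by translations.  The right edge of the square `i` is glued to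
the left edge of the square `right i`, and the top edge of `i` to the bottom edge of `up i`; every
edge is glued to exactly one edge, so both maps are permutations of the squares.
(Connectedness is not needed and is not imposed.) -/
structure PolysquareSurface (σ : Type*) where
  right : Equiv.Perm σ
  up : Equiv.Perm σ

/-- The fractional part of a real number, as an element of `[0,1)`. -/
noncomputable def unitFract (a : ℝ) : Set.Ico (0 : ℝ) 1 :=
  ⟨Int.fract a, Int.fract_nonneg a, Int.fract_lt_one a⟩

namespace PolysquareSurface

/-- Points: an atomic square and a position in the half-open unit square, so that each edge point
belongs to the square of which it is on the left or the bottom edge.  Every point of the surface has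
exactly one such label, except that a vertex of cone angle `2πk` has `k` labels; for `k ≥ 2` these
are the singular points, which no geodesic below ever meets. -/
abbrev Point {σ : Type*} (_P : PolysquareSurface σ) : Type _ :=
  σ × (Set.Ico (0 : ℝ) 1 × Set.Ico (0 : ℝ) 1)

variable {σ : Type*} (P : PolysquareSurface σ)

/-- A point is singular if it is a vertex whose cone angle is greater than `2π`: walking once around
the bottom left corner of the square (left, down, right, up) does not lead back to the square. -/
def IsSingular (p : P.Point) : Prop :=
  (p.2.1 : ℝ) = 0 ∧ (p.2.2 : ℝ) = 0 ∧ P.up (P.right (P.up⁻¹ (P.right⁻¹ p.1))) ≠ p.1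

/-- The flat local chart around `p`: the point `p + d`, for small displacements `d` (and
a point `p` that is not singular).  Leaving the square through an edge changes the square. -/
noncomputable def translate (p : P.Point) (d : ℝ × ℝ) : P.Point :=
  ((P.right ^ ⌊(p.2.1 : ℝ) + d.1⌋) ((P.up ^ ⌊(p.2.2 : ℝ) + d.2⌋) p.1),
    (unitFract (p.2.1 + d.1), unitFract (p.2.2 + d.2)))

/-- A half-infinite geodesic `L(t)`, `t ≥ 0`, with constant velocity vector `v`: it avoids the
singular points and is, around every time, a straight line in the flat chart. -/
def IsGeodesic (v : ℝ × ℝ) (L : ℝ≥0 → P.Point) : Prop :=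
  (∀ t, ¬ P.IsSingular (L t)) ∧
    ∀ t, ∀ᶠ s in 𝓝 t, L s = P.translate (L t) (((s : ℝ) - (t : ℝ)) • v)

/-- A half-infinite sequence `v₀ + j v`, `j = 0, 1, 2, …`: the points at the integer times of a
supporting half-infinite geodesic with velocity `v`. -/
def IsStepSequence (v : ℝ × ℝ) (a : ℕ → P.Point) : Prop :=
  ∃ L : ℝ≥0 → P.Point, P.IsGeodesic v L ∧ ∀ j : ℕ, a j = L j

open Classical in
/-- Uniform distribution: every convex set in an atomic square is visited with asymptotic
frequency equal to its area divided by the number of atomic squares. -/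
def UniformlyDistributed [Fintype σ] (a : ℕ → P.Point) : Prop :=
  ∀ (i : σ) (S : Set (ℝ × ℝ)), Convex ℝ S → S ⊆ Set.Ico 0 1 ×ˢ Set.Ico 0 1 →
    Tendsto
      (fun J : ℕ =>
        (((Finset.range J).filter
          fun j => (a j).1 = i ∧ (((a j).2.1 : ℝ), ((a j).2.2 : ℝ)) ∈ S).card : ℝ) / J)
      atTop (𝓝 (volume.real S / Fintype.card σ))

/-- The points of the associated `3`-manifold `M = P × [0,1)`, the product of the surface and the
unit torus `[0,1)` (a circle).  Its atomic cubes are the products of the atomic squares with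
`[0,1)`. -/
abbrev ProductPoint (P : PolysquareSurface σ) : Type _ := P.Point × Set.Ico (0 : ℝ) 1

/-- A half-infinite geodesic in `M = P × [0,1)` with constant velocity vector `(v, w)`.  The singular
points of `M` are the points above the singular points of `P`. -/
def IsProductGeodesic (v : ℝ × ℝ) (w : ℝ) (L : ℝ≥0 → P.ProductPoint) : Prop :=
  (∀ t, ¬ P.IsSingular (L t).1) ∧
    ∀ t, ∀ᶠ s in 𝓝 t,
      L s = (P.translate (L t).1 (((s : ℝ) - (t : ℝ)) • v),
        unitFract ((L t).2 + ((s : ℝ) - (t : ℝ)) * w))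

/-- A half-infinite sequence in `M = P × [0,1)` with step vector `(v, w)`. -/
def IsProductStepSequence (v : ℝ × ℝ) (w : ℝ) (a : ℕ → P.ProductPoint) : Prop :=
  ∃ L : ℝ≥0 → P.ProductPoint, P.IsProductGeodesic v w L ∧ ∀ j : ℕ, a j = L j

open Classical in
/-- Uniform distribution in `M = P × [0,1)`: every convex set in an atomic cube is visited with
asymptotic frequency equal to its volume divided by the number of atomic cubes. -/
def ProductUniformlyDistributed [Fintype σ] (a : ℕ → P.ProductPoint) : Prop :=
  ∀ (i : σ) (S : Set ((ℝ × ℝ) × ℝ)), Convex ℝ S →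
    S ⊆ (Set.Ico 0 1 ×ˢ Set.Ico 0 1) ×ˢ Set.Ico 0 1 →
    Tendsto
      (fun J : ℕ =>
        (((Finset.range J).filter
          fun j => (a j).1.1 = i ∧
            ((((a j).1.2.1 : ℝ), ((a j).1.2.2 : ℝ)), ((a j).2 : ℝ)) ∈ S).card : ℝ) / J)
      atTop (𝓝 (volume.real S / Fintype.card σ))

end PolysquareSurface

/-- `v = (v₁, v₂)` is a Kronecker vector: `v₁, v₂, 1` are linearly independent over `ℚ`. -/
def IsKroneckerVector₂ (v : ℝ × ℝ) : Prop :=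
  LinearIndependent ℚ ![v.1, v.2, 1]

/-- `(v, w) = (v₁, v₂, w)` is a Kronecker vector: `v₁, v₂, w, 1` are linearly independent
over `ℚ`. -/
def IsKroneckerVector₃ (v : ℝ × ℝ) (w : ℝ) : Prop :=
  LinearIndependent ℚ ![v.1, v.2, w, 1]

/-! ### Rotations of the unit square -/

/-! From M to P: choose `w` outside the countable rational span of v₁, v₂, 1, lift a geodesic of P
to M, and test the lifted sequence on cylinders S × [0,1).

From P to M: a sequence in M lies over a uniformly distributed sequence b_j on P, and its height is
z₀ + jw modulo 1. By Weyl's criterion with weights 1_C(b_j) (`tendsto_weighted_average_Ico`), it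
suffices that the averages of c^j 1_C(b_j) tend to 0 for c = e(kw), k ≠ 0.

Let T be the time-one flow on P. In coordinates it is a skew product over the rotation R by v of the
unit square, permuting the atomic squares in the fibres. If c·g∘T = g with |g| ∈ {0,1}, the product
of the nonzero values of g over the fibres with exactly r of them is a function h with c^r·h∘R = h
(`ae_eq_zero_of_skew_eigen`). Comparing Fourier coefficients gives h = 0 unless c^r = e(n·v) for
some n, that is, unless rkw is an integer combination of v₁, v₂, 1; independence excludes this for r
≥ 1. Hence g = 0 almost everywhere, and the mean ergodic theorem sends the twisted averages to 0 in
L². Ergodicity of T is not needed.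

To pass from L² to the given orbit, fix a length H. The flow is piecewise a translation with convex
pieces, so the squared modulus of the average of length H is a finite combination of indicators of
convex sets. Uniform distribution of b_j makes its mean along the orbit converge to its integral,
which is small, and Cauchy–Schwarz finishes (`tendsto_twisted_average_zero`). Products of convex
sets and intervals are then traded for arbitrary convex sets by weak convergence, since convex sets
have null boundary (`tendsto_average_indicator_convex`). -/

theorem coe_equivIco_coe (x : ℝ) :
    ((AddCircle.equivIco (1 : ℝ) 0 (x : UnitAddCircle) : ℝ)) = Int.fract x := by
  simp [AddCircle.coe_equivIco_mk_apply]

theorem measurable_equivIco_coe :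
    Measurable fun t : UnitAddCircle => (AddCircle.equivIco (1 : ℝ) 0 t : ℝ) :=
  measurable_subtype_coe.comp (AddCircle.measurableEquivIco (1 : ℝ) 0).measurable

/-- The map factors through the circle: project, translate, and return by the section with values in
[0,1). Each factor preserves measure. -/
theorem measurePreserving_fract_add (d : ℝ) :
    MeasurePreserving (fun x : ℝ => Int.fract (x + d)) (volume.restrict (Set.Ico 0 1))
      (volume.restrict (Set.Ico 0 1)) := by
  have h1 : MeasurePreserving ((↑) : ℝ → UnitAddCircle) (volume.restrict (Set.Ico (0 : ℝ) 1))
      volume := by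
    have := UnitAddCircle.measurePreserving_mk 0
    rwa [zero_add, Measure.restrict_congr_set Ico_ae_eq_Ioc.symm] at this
  have h2 : MeasurePreserving (fun t : UnitAddCircle => (AddCircle.equivIco (1 : ℝ) 0 t : ℝ))
      volume (volume.restrict (Set.Ico (0 : ℝ) 1)) := by
    refine ⟨measurable_equivIco_coe, ?_⟩
    rw [← h1.map_eq, Measure.map_map measurable_equivIco_coe h1.measurable]
    conv_rhs => rw [← Measure.map_id (μ := volume.restrict (Set.Ico (0 : ℝ) 1))]
    apply Measure.map_congr
    filter_upwards [ae_restrict_mem measurableSet_Ico] with x hx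
    simp only [Function.comp_apply, coe_equivIco_coe, id]
    exact Int.fract_eq_self.2 hx
  have h3 := h2.comp ((measurePreserving_add_right volume (d : UnitAddCircle)).comp h1)
  convert h3 using 2 with x
  simp only [Function.comp_apply, ← AddCircle.coe_add, coe_equivIco_coe]

/-- Lebesgue measure on the half-open unit square. -/
noncomputable def unitSquareMeasure : Measure (ℝ × ℝ) :=
  volume.restrict (Set.Ico 0 1 ×ˢ Set.Ico 0 1)

theorem unitSquareMeasure_eq_prod : unitSquareMeasure =
    (volume.restrict (Set.Ico (0 : ℝ) 1)).prod (volume.restrict (Set.Ico (0 : ℝ) 1)) := by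
  rw [Measure.prod_restrict]; rfl

instance : IsProbabilityMeasure unitSquareMeasure := by
  rw [unitSquareMeasure_eq_prod]
  have : IsProbabilityMeasure (volume.restrict (Set.Ico (0 : ℝ) 1)) := ⟨by simp⟩
  infer_instance

/-- Rotation by `d` of the unit square, seen as a torus. -/
noncomputable def rotateSquare (d x : ℝ × ℝ) : ℝ × ℝ :=
  (Int.fract (x.1 + d.1), Int.fract (x.2 + d.2))

theorem measurePreserving_rotateSquare (d : ℝ × ℝ) :
    MeasurePreserving (rotateSquare d) unitSquareMeasure unitSquareMeasure := by
  rw [unitSquareMeasure_eq_prod]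
  exact (measurePreserving_fract_add d.1).prod (measurePreserving_fract_add d.2)

theorem ae_mem_unitSquare :
    ∀ᵐ x ∂unitSquareMeasure, x ∈ Set.Ico (0 : ℝ) 1 ×ˢ Set.Ico (0 : ℝ) 1 :=
  ae_restrict_mem (measurableSet_Ico.prod measurableSet_Ico)

/-- A bounded function on the torus all of whose Fourier coefficients vanish is zero. -/
theorem ae_eq_zero_of_integral_mFourier_eq_zero {d : Type*} [Fintype d]
    (μ : Measure (UnitAddTorus d)) [IsFiniteMeasure μ] (H : UnitAddTorus d → ℂ)
    (hH : Measurable H) (hb : ∀ t, ‖H t‖ ≤ 1)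
    (h0 : ∀ n, ∫ t, UnitAddTorus.mFourier n t * H t ∂μ = 0) : H =ᵐ[μ] 0 := by
  have hint : Integrable H μ := .of_bound hH.aestronglyMeasurable 1 (.of_forall hb)
  have hcont : ∀ φ : C(UnitAddTorus d, ℂ), ∫ t, φ t * H t ∂μ = 0 := by
    have hφint : ∀ φ : C(UnitAddTorus d, ℂ), Integrable (fun t => φ t * H t) μ := fun φ =>
      hint.bdd_mul φ.continuous.aestronglyMeasurable (c := ‖φ‖)
        (.of_forall fun t => φ.norm_coe_le_norm t)
    let Λ : C(UnitAddTorus d, ℂ) →ₗ[ℂ] ℂ :=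
      { toFun := fun φ => ∫ t, φ t * H t ∂μ
        map_add' := fun φ ψ => by
          simp only [ContinuousMap.add_apply, add_mul]
          exact integral_add (hφint φ) (hφint ψ)
        map_smul' := fun c φ => by
          simp only [ContinuousMap.smul_apply, smul_eq_mul, mul_assoc, RingHom.id_apply]
          exact integral_const_mul _ _ }
    let Λc : C(UnitAddTorus d, ℂ) →L[ℂ] ℂ := Λ.mkContinuous (μ.real Set.univ) fun φ => by
      have := norm_integral_le_of_norm_le_const (μ := μ) (f := fun t => φ t * H t) (C := ‖φ‖)
        (.of_forall fun t => by
          rw [norm_mul]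
          exact (mul_le_mul (φ.norm_coe_le_norm t) (hb t) (norm_nonneg _) (norm_nonneg _)).trans
            (mul_one _).le)
      rw [mul_comm]
      exact this
    -- The bounded functional φ ↦ ∫ φH vanishes on the characters, hence on their closed span, which
    -- is all of C(torus).
    have hle : (Submodule.span ℂ (Set.range (UnitAddTorus.mFourier (d := d)))).topologicalClosure
        ≤ LinearMap.ker (Λc : C(UnitAddTorus d, ℂ) →ₗ[ℂ] ℂ) := by
      apply Submodule.topologicalClosure_minimal
      · rw [Submodule.span_le]
        rintro _ ⟨n, rfl⟩
        exact h0 n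
      · exact Λc.isClosed_ker
    rw [UnitAddTorus.span_mFourier_closure_eq_top] at hle
    exact fun φ => hle (Submodule.mem_top : φ ∈ ⊤)
  have hm : MemLp H 2 μ := .of_bound hH.aestronglyMeasurable 1 (.of_forall hb)
  have hz : hm.toLp H = 0 := by
    refine (ContinuousMap.toLp_denseRange ℂ μ ℂ (p := 2) (by simp)).eq_zero_of_inner_left ℂ ?_
    rintro φ
    rw [← inner_conj_symm, L2.inner_def]
    have : ∫ a, inner ℂ ((ContinuousMap.toLp 2 μ ℂ φ) a) ((hm.toLp H) a) ∂μ =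
        ∫ t, (star φ) t * H t ∂μ := by
      apply integral_congr_ae
      filter_upwards [ContinuousMap.coeFn_toLp (p := 2) (𝕜 := ℂ) μ φ, hm.coeFn_toLp] with t h1 h2
      rw [h1, h2]
      simp [mul_comm]
    rw [this, hcont, map_zero]
  have := hm.coeFn_toLp
  rw [hz] at this
  exact this.symm.trans (Lp.coeFn_zero _ _ _)

/-- The character `e(n·x)` of the plane. -/
noncomputable def planeChar (n : ℤ × ℤ) (x : ℝ × ℝ) : ℂ :=
  Complex.exp (2 * Real.pi * Complex.I * (n.1 * x.1 + n.2 * x.2))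

theorem planeChar_eq_fourier (n : ℤ × ℤ) (x : ℝ × ℝ) : planeChar n x =
    fourier n.1 (x.1 : UnitAddCircle) * fourier n.2 (x.2 : UnitAddCircle) := by
  rw [fourier_coe_apply, fourier_coe_apply, planeChar, ← Complex.exp_add]
  congr 1
  push_cast
  ring

theorem coe_fract_unitAddCircle (x : ℝ) : ((Int.fract x : ℝ) : UnitAddCircle) = x := by
  rw [← sub_eq_zero, ← AddCircle.coe_sub, AddCircle.coe_eq_zero_iff]
  exact ⟨-⌊x⌋, by rw [← Int.self_sub_floor]; simp⟩

theorem planeChar_rotateSquare (n : ℤ × ℤ) (d x : ℝ × ℝ) :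
    planeChar n (rotateSquare d x) = planeChar n d * planeChar n x := by
  simp only [planeChar_eq_fourier, rotateSquare, coe_fract_unitAddCircle]
  simp only [fourier_coe_apply, ← Complex.exp_add]
  congr 1
  push_cast
  ring

theorem measurable_planeChar (n : ℤ × ℤ) : Measurable (planeChar n) := by
  unfold planeChar
  fun_prop

/-- The torus statement holds for any finite measure, so it is applied to the image of the square's
measure under the projection `Φ`; that image never has to be identified with Haar measure. -/
theorem ae_eq_zero_of_integral_planeChar_eq_zero (h : ℝ × ℝ → ℂ) (hh : Measurable h)
    (hb : ∀ x, ‖h x‖ ≤ 1) (h0 : ∀ n, ∫ x, planeChar n x * h x ∂unitSquareMeasure = 0) :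
    h =ᵐ[unitSquareMeasure] 0 := by
  let Φ : ℝ × ℝ → UnitAddTorus (Fin 2) := fun x => ![(x.1 : UnitAddCircle), (x.2 : UnitAddCircle)]
  let Ψ : UnitAddTorus (Fin 2) → ℝ × ℝ := fun t =>
    ((AddCircle.equivIco (1 : ℝ) 0 (t 0) : ℝ), (AddCircle.equivIco (1 : ℝ) 0 (t 1) : ℝ))
  have hΦ : Measurable Φ := by
    refine measurable_pi_iff.2 fun i => ?_
    fin_cases i
    · exact AddCircle.measurable_mk'.comp measurable_fst
    · exact AddCircle.measurable_mk'.comp measurable_snd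
  have hΨ : Measurable Ψ := (measurable_equivIco_coe.comp (measurable_pi_apply 0)).prodMk
    (measurable_equivIco_coe.comp (measurable_pi_apply 1))
  have hΨΦ : ∀ᵐ x ∂unitSquareMeasure, Ψ (Φ x) = x := by
    filter_upwards [ae_mem_unitSquare] with x hx
    simp only [Φ, Ψ, Matrix.cons_val_zero, Matrix.cons_val_one, coe_equivIco_coe]
    rw [Int.fract_eq_self.2 hx.1, Int.fract_eq_self.2 hx.2]
  have key := ae_eq_zero_of_integral_mFourier_eq_zero (unitSquareMeasure.map Φ) (h ∘ Ψ)
    (hh.comp hΨ) (fun t => hb _) fun n => by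
      have hmeas : Measurable fun t => UnitAddTorus.mFourier n t * (h ∘ Ψ) t :=
        (UnitAddTorus.mFourier n).continuous.measurable.mul (hh.comp hΨ)
      rw [integral_map hΦ.aemeasurable hmeas.aestronglyMeasurable, ← h0 (n 0, n 1)]
      apply integral_congr_ae
      filter_upwards [hΨΦ] with x hx
      rw [Function.comp_apply, hx, planeChar_eq_fourier]
      simp [UnitAddTorus.mFourier, Fin.prod_univ_two, Φ]
  filter_upwards [ae_of_ae_map hΦ.aemeasurable key, hΨΦ] with x h1 h2
  simpa [h2] using h1

/-- A rotation of the torus has no eigenfunction beyond those given by the characters. -/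
theorem ae_eq_zero_of_rotateSquare_eigen (d : ℝ × ℝ) (c : ℂ) (hc : ∀ n, planeChar n d ≠ c)
    (h : ℝ × ℝ → ℂ) (hh : Measurable h) (hb : ∀ x, ‖h x‖ ≤ 1)
    (he : ∀ᵐ x ∂unitSquareMeasure, c * h (rotateSquare d x) = h x) :
    h =ᵐ[unitSquareMeasure] 0 := by
  refine ae_eq_zero_of_integral_planeChar_eq_zero h hh hb fun n => ?_
  have h1 : ∫ x, planeChar n x * h x ∂unitSquareMeasure =
      ∫ x, planeChar n (rotateSquare d x) * h (rotateSquare d x) ∂unitSquareMeasure := by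
    have hm := measurePreserving_rotateSquare d
    rw [← integral_map (φ := rotateSquare d) (f := fun x => planeChar n x * h x)
      hm.measurable.aemeasurable
      ((measurable_planeChar n).mul hh).aestronglyMeasurable, hm.map_eq]
  -- Invariance of the integral under the rotation: the n-th coefficient is multiplied by c on one
  -- side and by e(n·d) on the other.
  have h2 : c * ∫ x, planeChar n x * h x ∂unitSquareMeasure =
      planeChar n d * ∫ x, planeChar n x * h x ∂unitSquareMeasure := by
    conv_lhs => rw [h1]
    rw [← integral_const_mul, ← integral_const_mul]
    apply integral_congr_ae
    filter_upwards [he] with x hx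
    rw [planeChar_rotateSquare, ← hx]
    ring
  by_contra hne
  exact hc n (mul_right_cancel₀ hne h2).symm

/-! ### Twisted ergodic averages -/

theorem norm_sq_toLp_eq_integral {X : Type*} [MeasurableSpace X] {m : Measure X} {F : X → ℂ}
    (hF : MemLp F 2 m) : ‖hF.toLp F‖ ^ 2 = ∫ p, ‖F p‖ ^ 2 ∂m := by
  have h1 : ((‖hF.toLp F‖ ^ 2 : ℝ) : ℂ) = ((∫ p, ‖F p‖ ^ 2 ∂m : ℝ) : ℂ) := by
    rw [← integral_complex_ofReal]
    have h2 : inner ℂ (hF.toLp F) (hF.toLp F) = ((‖hF.toLp F‖ ^ 2 : ℝ) : ℂ) := by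
      rw [inner_self_eq_norm_sq_to_K]; push_cast; rfl
    rw [← h2, L2.inner_def]
    apply integral_congr_ae
    filter_upwards [hF.coeFn_toLp] with p hp
    rw [hp, inner_self_eq_norm_sq_to_K]
    push_cast
    rfl
  exact_mod_cast h1

/-- Von Neumann's mean ergodic theorem for the contraction g ↦ c·g∘T: the limit is the projection to
its fixed vectors, and `hno` leaves only 0 there. -/
theorem tendsto_integral_norm_sq_twisted_average {X : Type*} [MeasurableSpace X] (m : Measure X)
    [IsFiniteMeasure m] (T : X → X) (hT : MeasurePreserving T m m) (c : ℂ) (hc : ‖c‖ = 1)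
    (hno : ∀ g : X → ℂ, Measurable g → (∀ p, g p = 0 ∨ ‖g p‖ = 1) →
      (∀ᵐ p ∂m, c * g (T p) = g p) → g =ᵐ[m] 0)
    (f : X → ℂ) (hf : Measurable f) (hb : ∀ p, ‖f p‖ ≤ 1) :
    Tendsto (fun H : ℕ => ∫ p, ‖(H : ℂ)⁻¹ * ∑ h ∈ Finset.range H, c ^ h * f (T^[h] p)‖ ^ 2 ∂m)
      atTop (𝓝 0) := by
  let K : Lp ℂ 2 m →L[ℂ] Lp ℂ 2 m :=
    (Lp.compMeasurePreservingₗᵢ ℂ T hT).toContinuousLinearMap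
  let U : Lp ℂ 2 m →L[ℂ] Lp ℂ 2 m := c • K
  have hUapp : ∀ g : Lp ℂ 2 m, (U g : X → ℂ) =ᵐ[m] fun p => c * g (T p) := by
    intro g
    have h1 : U g = c • Lp.compMeasurePreserving T hT g := rfl
    rw [h1]
    filter_upwards [Lp.coeFn_smul c (Lp.compMeasurePreserving T hT g),
      Lp.coeFn_compMeasurePreserving g hT] with p h2 h3
    rw [h2, Pi.smul_apply, h3]
    rfl
  have hU : ‖U‖ ≤ 1 := by
    refine (norm_smul_le c K).trans ?_
    rw [hc, one_mul]
    exact LinearIsometry.norm_toContinuousLinearMap_le _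
  have hfix : ∀ g : Lp ℂ 2 m, U g = g → g = 0 := by
    intro g hg
    have hge : ∀ᵐ p ∂m, c * g (T p) = g p := by
      have := hUapp g
      rw [hg] at this
      filter_upwards [this] with p hp using hp.symm
    have hgm : Measurable (g : X → ℂ) := (Lp.stronglyMeasurable g).measurable
    -- The modulus of a fixed vector is T-invariant, so dividing by it preserves the equation; where
    -- g vanishes, 0/0 = 0.
    have h0 := hno (fun p => g p / ‖g p‖) (hgm.div (Complex.measurable_ofReal.comp hgm.norm))
      (fun p => by
        by_cases h : g p = 0
        · simp [h]
        · right
          rw [norm_div, Complex.norm_real, norm_norm, div_self (norm_ne_zero_iff.2 h)])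
      (by
        filter_upwards [hge] with p hp
        have hn : ‖g (T p)‖ = ‖g p‖ := by rw [← hp, norm_mul, hc, one_mul]
        rw [hn, ← mul_div_assoc, hp])
    refine Lp.ext ?_
    filter_upwards [h0, Lp.coeFn_zero ℂ 2 m] with p hp hz
    rw [hz]
    simpa using hp
  have hmeas : ∀ h : ℕ, Measurable fun p => c ^ h * f (T^[h] p) := fun h =>
    (hf.comp (hT.measurable.iterate h)).const_mul _
  have hmem : ∀ h : ℕ, MemLp (fun p => c ^ h * f (T^[h] p)) 2 m := fun h =>
    .of_bound (hmeas h).aestronglyMeasurable 1 (.of_forall fun p => by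
      rw [norm_mul, norm_pow, hc, one_pow, one_mul]; exact hb _)
  have hf2 : MemLp f 2 m := .of_bound hf.aestronglyMeasurable 1 (.of_forall hb)
  have hiter : ∀ h : ℕ, (U^[h] (hf2.toLp f) : X → ℂ) =ᵐ[m] fun p => c ^ h * f (T^[h] p) := by
    intro h
    induction h with
    | zero => simpa using hf2.coeFn_toLp
    | succ h ih =>
      rw [Function.iterate_succ_apply']
      filter_upwards [hUapp (U^[h] (hf2.toLp f)), hT.quasiMeasurePreserving.ae ih] with p h1 h2
      rw [h1, h2, pow_succ', Function.iterate_succ_apply, mul_assoc]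
  have hlim := U.tendsto_birkhoffAverage_orthogonalProjection hU (hf2.toLp f)
  have hP : ((((U : Lp ℂ 2 m →ₗ[ℂ] Lp ℂ 2 m).eqLocus
      ((1 : Lp ℂ 2 m →L[ℂ] Lp ℂ 2 m) : Lp ℂ 2 m →ₗ[ℂ] Lp ℂ 2 m)).orthogonalProjectionOnto
        (hf2.toLp f) : _) : Lp ℂ 2 m) = 0 :=
    hfix _ (LinearMap.mem_eqLocus.1
      (Submodule.orthogonalProjectionOnto ((U : Lp ℂ 2 m →ₗ[ℂ] Lp ℂ 2 m).eqLocus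
        ((1 : Lp ℂ 2 m →L[ℂ] Lp ℂ 2 m) : Lp ℂ 2 m →ₗ[ℂ] Lp ℂ 2 m)) (hf2.toLp f)).2)
  have hlim2 := (hlim.norm.pow 2)
  erw [hP] at hlim2
  rw [norm_zero, zero_pow two_ne_zero] at hlim2
  refine hlim2.congr fun H => ?_
  have hFm : MemLp (fun p => (H : ℂ)⁻¹ * ∑ h ∈ Finset.range H, c ^ h * f (T^[h] p)) 2 m :=
    (memLp_finsetSum _ fun h _ => hmem h).const_mul _
  rw [← norm_sq_toLp_eq_integral hFm]
  congr 2
  refine Lp.ext ?_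
  rw [birkhoffAverage, birkhoffSum]
  have hall : ∀ᵐ p ∂m, ∀ h : ℕ, (U^[h] (hf2.toLp f) : X → ℂ) p = c ^ h * f (T^[h] p) :=
    ae_all_iff.2 hiter
  filter_upwards [hall, hFm.coeFn_toLp,
    Lp.coeFn_smul (H : ℂ)⁻¹ (∑ k ∈ Finset.range H, id (U^[k] (hf2.toLp f))),
    Lp.coeFn_finsetSum (Finset.range H) (fun k => id (U^[k] (hf2.toLp f)))] with p h1 h2 h3 h4
  rw [h2, h3, Pi.smul_apply, h4, Finset.sum_apply, smul_eq_mul]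
  simp only [id, h1]

open Classical in
/-- A finite extension of a system with no eigenfunction for any power `c ^ r` has no eigenfunction
for `c`. -/
theorem ae_eq_zero_of_skew_eigen {Y σ : Type*} [Fintype σ] [MeasurableSpace Y] [MeasurableSpace σ]
    [DiscreteMeasurableSpace σ] (ν : Measure Y) [SFinite ν] (R : Y → Y) (π : Y → Equiv.Perm σ)
    (c : ℂ) (hc : ‖c‖ = 1)
    (hbase : ∀ r : ℕ, 1 ≤ r → ∀ h : Y → ℂ, Measurable h → (∀ y, ‖h y‖ ≤ 1) →
      (∀ᵐ y ∂ν, c ^ r * h (R y) = h y) → h =ᵐ[ν] 0)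
    (g : Y × σ → ℂ) (hg : Measurable g) (h01 : ∀ p, g p = 0 ∨ ‖g p‖ = 1)
    (he : ∀ᵐ p ∂(ν.prod Measure.count), c * g (R p.1, π p.1 p.2) = g p) :
    g =ᵐ[ν.prod Measure.count] 0 := by
  have hc0 : c ≠ 0 := norm_ne_zero_iff.1 (by rw [hc]; exact one_ne_zero)
  have hy : ∀ᵐ y ∂ν, ∀ i, c * g (R y, π y i) = g (y, i) := by
    filter_upwards [Measure.ae_ae_of_ae_prod he] with y h1
    exact Measure.ae_count_iff.1 h1
  have hgi : ∀ i, Measurable fun y => g (y, i) := fun i => hg.comp measurable_prodMk_right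
  -- `N` counts the nonzero values in a fibre, and `k` replaces zeros by 1 so that the product sees
  -- only nonzero values. Splitting by `N y = r` gives every function `h r` the single multiplier
  -- c^r. Both `N` and the product are insensitive to the permutation `π y`.
  let N : Y → ℕ := fun y => ∑ i, if g (y, i) = 0 then 0 else 1
  let k : ℂ → ℂ := fun z => if z = 0 then 1 else z
  let h : ℕ → Y → ℂ := fun r y => if N y = r then ∏ i, k (g (y, i)) else 0
  have hN : Measurable N := Finset.measurable_sum _ fun i _ =>
    Measurable.ite (hgi i (measurableSet_singleton 0)) measurable_const measurable_const
  have hk : Measurable k :=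
    Measurable.ite (measurableSet_singleton 0) measurable_const measurable_id
  have hkn : ∀ p, ‖k (g p)‖ = 1 := by
    intro p
    by_cases hp : g p = 0
    · simp [k, hp]
    · simpa [k, hp] using (h01 p).resolve_left hp
  have hh : ∀ r, Measurable (h r) := fun r =>
    Measurable.ite (hN (measurableSet_singleton r))
      (Finset.measurable_prod _ fun i _ => hk.comp (hgi i)) measurable_const
  have hprod : ∀ y, ‖∏ i, k (g (y, i))‖ = 1 := fun y => by
    rw [norm_prod]; simp [hkn]
  have hhb : ∀ r y, ‖h r y‖ ≤ 1 := by
    intro r y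
    simp only [h]
    split_ifs
    · exact (hprod y).le
    · simp
  have hhe : ∀ r, ∀ᵐ y ∂ν, c ^ r * h r (R y) = h r y := by
    intro r
    filter_upwards [hy] with y hy
    have hz : ∀ i, g (R y, π y i) = 0 ↔ g (y, i) = 0 := fun i => by
      rw [← hy i]; simp [hc0]
    have hNR : N (R y) = N y := by
      simp only [N]
      rw [← Equiv.sum_comp (π y)]
      simp only [hz]
    simp only [h, hNR]
    split_ifs with hr
    · rw [← hr, ← Equiv.prod_comp (π y), ← Finset.prod_pow_eq_pow_sum, ← Finset.prod_mul_distrib]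
      refine Finset.prod_congr rfl fun i _ => ?_
      simp only [k, hz]
      split_ifs with h0
      · simp
      · rw [pow_one, hy]
    · simp
  have hall : ∀ᵐ y ∂ν, ∀ r : ℕ, 1 ≤ r → h r y = 0 := by
    rw [ae_all_iff]
    intro r
    by_cases hr : 1 ≤ r
    · filter_upwards [hbase r hr (h r) (hh r) (hhb r) (hhe r)] with y hy _ using hy
    · exact .of_forall fun y h => absurd h hr
  have hset : MeasurableSet {p : Y × σ | g p = 0} := hg (measurableSet_singleton 0)
  refine (Measure.ae_prod_iff_ae_ae hset).2 ?_
  filter_upwards [hall] with y hy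
  refine .of_forall fun i => ?_
  have hN0 : N y = 0 := by
    by_contra hne
    have := hy (N y) (Nat.one_le_iff_ne_zero.2 hne)
    simp only [h, if_true] at this
    have h1 := hprod y
    rw [this] at h1
    simp at h1
  have := Finset.sum_eq_zero_iff.1 hN0 i (Finset.mem_univ i)
  by_contra hne
  change ¬ g (y, i) = 0 at hne
  simp [hne] at this

/-! ### The flow for a short time -/

/-- The time at which a point moving with velocity `d` from `x ∈ [0,1)` leaves `[0,1)`. -/
noncomputable def crossTime (d x : ℝ) : ℝ := ((if 0 < d then 1 else 0) - x) / d

theorem measurable_crossTime (d : ℝ) : Measurable (crossTime d) := by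
  unfold crossTime
  fun_prop

namespace PolysquareSurface

variable {σ : Type*} (P : PolysquareSurface σ)

/-- The permutation of the squares caused by a crossing of `a` vertical and `b` horizontal edges, the
vertical ones being crossed first if `o` holds. -/
def crossPerm (o : Prop) [Decidable o] (a b : ℤ) : Equiv.Perm σ :=
  if o then P.up ^ b * P.right ^ a else P.right ^ a * P.up ^ b

open Classical in
/-- The flow by a displacement `d` shorter than the sides of the squares. -/
noncomputable def stepMap (d : ℝ × ℝ) (p : (ℝ × ℝ) × σ) : (ℝ × ℝ) × σ :=
  (rotateSquare d p.1,
    P.crossPerm (crossTime d.1 p.1.1 < crossTime d.2 p.1.2) ⌊p.1.1 + d.1⌋ ⌊p.1.2 + d.2⌋ p.2)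

-- The base is a measure-preserving rotation and each fibre map is a permutation, which preserves
-- counting measure. Measurability holds because the permutation depends on the base point only
-- through countably many values.
open Classical in
theorem measurePreserving_stepMap [Fintype σ] [MeasurableSpace σ] [DiscreteMeasurableSpace σ]
    (d : ℝ × ℝ) :
    MeasurePreserving (P.stepMap d) (unitSquareMeasure.prod Measure.count)
      (unitSquareMeasure.prod Measure.count) := by
  refine (measurePreserving_rotateSquare d).skew_product (g := fun x i =>
    P.crossPerm (crossTime d.1 x.1 < crossTime d.2 x.2) ⌊x.1 + d.1⌋ ⌊x.2 + d.2⌋ i) ?_ ?_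
  · have h1 : Measurable fun q : (Bool × ℤ × ℤ) × σ =>
        P.crossPerm (q.1.1 = true) q.1.2.1 q.1.2.2 q.2 := measurable_of_countable _
    have h2 : Measurable fun x : ℝ × ℝ =>
        (decide (crossTime d.1 x.1 < crossTime d.2 x.2), ⌊x.1 + d.1⌋, ⌊x.2 + d.2⌋) := by
      refine Measurable.prodMk ?_ (Measurable.prodMk ?_ ?_)
      · refine measurable_to_bool ?_
        have : ((fun x : ℝ × ℝ => decide (crossTime d.1 x.1 < crossTime d.2 x.2)) ⁻¹' {true}) =
            {x | crossTime d.1 x.1 < crossTime d.2 x.2} := by ext; simp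
        rw [this]
        exact measurableSet_lt ((measurable_crossTime _).comp measurable_fst)
          ((measurable_crossTime _).comp measurable_snd)
      · exact Int.measurable_floor.comp (by fun_prop)
      · exact Int.measurable_floor.comp (by fun_prop)
    have h3 := h1.comp ((h2.comp measurable_fst).prodMk measurable_snd)
    convert h3 using 1
    ext q
    simp [Function.uncurry, crossPerm]
  · refine .of_forall fun x => ?_
    ext s hs
    rw [Measure.map_apply (Measurable.of_discrete) hs,
      Measure.count_apply MeasurableSet.of_discrete, Measure.count_apply hs]
    congr 1
    exact Set.encard_preimage_of_bijective (Equiv.bijective _) _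
end PolysquareSurface

/-! ### Piecewise constant functions with convex pieces -/

/-- The linear combinations of indicator functions of convex subsets of the squares. -/
noncomputable def convexStepFunctions (σ : Type*) : Submodule ℂ ((ℝ × ℝ) × σ → ℂ) :=
  Submodule.span ℂ {F | ∃ (C : Set (ℝ × ℝ)) (i : σ), Convex ℝ C ∧ MeasurableSet C ∧
    C ⊆ Set.Ico 0 1 ×ˢ Set.Ico 0 1 ∧ F = (C ×ˢ {i}).indicator 1}

theorem indicator_mem_convexStepFunctions {σ : Type*} {C : Set (ℝ × ℝ)} (i : σ)
    (hC : Convex ℝ C) (hm : MeasurableSet C) (hQ : C ⊆ Set.Ico 0 1 ×ˢ Set.Ico 0 1) :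
    (C ×ˢ {i}).indicator 1 ∈ convexStepFunctions σ :=
  Submodule.subset_span ⟨C, i, hC, hm, hQ, rfl⟩

theorem measurable_of_mem_convexStepFunctions {σ : Type*} [MeasurableSpace σ]
    [DiscreteMeasurableSpace σ] {F : (ℝ × ℝ) × σ → ℂ} (hF : F ∈ convexStepFunctions σ) :
    Measurable F := by
  induction hF using Submodule.span_induction with
  | mem F h =>
    obtain ⟨C, i, -, hm, -, rfl⟩ := h
    exact measurable_one.indicator (hm.prod (MeasurableSet.of_discrete))
  | zero => exact measurable_zero
  | add F G _ _ hF hG => exact hF.add hG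
  | smul c F _ hF => exact hF.const_smul c

theorem mul_mem_convexStepFunctions {σ : Type*} {F G : (ℝ × ℝ) × σ → ℂ}
    (hF : F ∈ convexStepFunctions σ) (hG : G ∈ convexStepFunctions σ) :
    F * G ∈ convexStepFunctions σ := by
  have h := Submodule.mul_mem_mul hF hG
  rw [convexStepFunctions, Submodule.span_mul_span] at h
  refine Submodule.span_le.2 ?_ h
  rintro _ ⟨_, ⟨C, i, hC, hCm, hCQ, rfl⟩, _, ⟨D, j, hD, hDm, hDQ, rfl⟩, rfl⟩
  change (C ×ˢ {i}).indicator 1 * (D ×ˢ {j}).indicator 1 ∈ convexStepFunctions σ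
  have hmul : (C ×ˢ {i}).indicator 1 * (D ×ˢ {j}).indicator 1 =
      ((C ×ˢ {i}) ∩ (D ×ˢ {j})).indicator (1 : (ℝ × ℝ) × σ → ℂ) := by
    rw [Set.inter_indicator_one]
  rw [hmul, Set.prod_inter_prod]
  by_cases hij : i = j
  · subst hij
    rw [Set.inter_self]
    exact indicator_mem_convexStepFunctions i (hC.inter hD) (hCm.inter hDm)
      (Set.inter_subset_left.trans hCQ)
  · have : ({i} ∩ {j} : Set σ) = ∅ := by simpa using Ne.symm hij
    rw [this, Set.prod_empty, Set.indicator_empty]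
    exact Submodule.zero_mem _

theorem star_mem_convexStepFunctions {σ : Type*} {F : (ℝ × ℝ) × σ → ℂ}
    (hF : F ∈ convexStepFunctions σ) : star F ∈ convexStepFunctions σ := by
  induction hF using Submodule.span_induction with
  | mem F h =>
    obtain ⟨C, i, hC, hm, hQ, rfl⟩ := h
    convert indicator_mem_convexStepFunctions i hC hm hQ using 1
    ext p
    by_cases hp : p ∈ C ×ˢ {i} <;> simp [hp]
  | zero => rw [star_zero]; exact Submodule.zero_mem _
  | add F G _ _ hF hG => rw [star_add]; exact Submodule.add_mem _ hF hG
  | smul c F _ hF => rw [star_smul]; exact Submodule.smul_mem _ _ hF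

theorem support_subset_of_mem_convexStepFunctions {σ : Type*} {F : (ℝ × ℝ) × σ → ℂ}
    (hF : F ∈ convexStepFunctions σ) :
    Function.support F ⊆ (Set.Ico 0 1 ×ˢ Set.Ico 0 1) ×ˢ Set.univ := by
  induction hF using Submodule.span_induction with
  | mem F h =>
    obtain ⟨C, i, -, -, hQ, rfl⟩ := h
    exact Set.support_indicator_subset.trans (Set.prod_mono hQ (Set.subset_univ _))
  | zero => simp
  | add F G _ _ hF hG =>
    exact (Function.support_add F G).trans (Set.union_subset hF hG)
  | smul c F _ hF => exact (Function.support_const_smul_subset c F).trans hF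

/-- The squared modulus of a linear combination of step functions is a step function. -/
theorem norm_sq_mem_convexStepFunctions {σ : Type*} {F : (ℝ × ℝ) × σ → ℂ}
    (hF : F ∈ convexStepFunctions σ) :
    (fun p => ((‖F p‖ ^ 2 : ℝ) : ℂ)) ∈ convexStepFunctions σ := by
  convert mul_mem_convexStepFunctions (star_mem_convexStepFunctions hF) hF using 1
  ext p
  rw [Pi.mul_apply, Pi.star_apply, RCLike.star_def, Complex.conj_mul']
  push_cast
  rfl

theorem integrable_of_mem_convexStepFunctions {σ : Type*} [Fintype σ] [MeasurableSpace σ]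
    [DiscreteMeasurableSpace σ] {F : (ℝ × ℝ) × σ → ℂ} (hF : F ∈ convexStepFunctions σ) :
    Integrable F (unitSquareMeasure.prod Measure.count) := by
  induction hF using Submodule.span_induction with
  | mem F h =>
    obtain ⟨C, i, -, hm, -, rfl⟩ := h
    exact (integrable_const (1 : ℂ)).indicator (hm.prod (MeasurableSet.of_discrete))
  | zero => exact integrable_zero _ _ _
  | add F G _ _ hF hG => exact hF.add hG
  | smul c F _ hF => exact hF.smul c

/-- Equidistribution in convex sets implies the convergence of the averages of step functions. -/
theorem tendsto_average_of_mem_convexStepFunctions {σ : Type*} [Fintype σ] [MeasurableSpace σ]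
    [DiscreteMeasurableSpace σ] (b : ℕ → (ℝ × ℝ) × σ)
    (hb : ∀ (C : Set (ℝ × ℝ)) (i : σ), Convex ℝ C → MeasurableSet C →
      C ⊆ Set.Ico 0 1 ×ˢ Set.Ico 0 1 →
      Tendsto (fun J : ℕ => (J : ℂ)⁻¹ *
        ∑ j ∈ Finset.range J, (C ×ˢ {i}).indicator (1 : (ℝ × ℝ) × σ → ℂ) (b j)) atTop
        (𝓝 ((volume.real C / Fintype.card σ : ℝ) : ℂ)))
    {F : (ℝ × ℝ) × σ → ℂ} (hF : F ∈ convexStepFunctions σ) :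
    Tendsto (fun J : ℕ => (J : ℂ)⁻¹ * ∑ j ∈ Finset.range J, F (b j)) atTop
      (𝓝 ((Fintype.card σ : ℂ)⁻¹ * ∫ p, F p ∂(unitSquareMeasure.prod Measure.count))) := by
  induction hF using Submodule.span_induction with
  | mem F h =>
    obtain ⟨C, i, hC, hm, hQ, rfl⟩ := h
    convert hb C i hC hm hQ using 2
    have h1 : ∫ p, (C ×ˢ {i}).indicator (1 : (ℝ × ℝ) × σ → ℂ) p
        ∂(unitSquareMeasure.prod Measure.count) =
        ((unitSquareMeasure.prod Measure.count).real (C ×ˢ {i}) : ℂ) := by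
      rw [integral_indicator (hm.prod (MeasurableSet.of_discrete))]
      simp
    rw [h1, measureReal_prod_prod, unitSquareMeasure, measureReal_restrict_apply hm, Set.inter_eq_left.2 hQ]
    simp [div_eq_inv_mul]
  | zero => simp
  | add F G hF' hG' hF hG =>
    convert hF.add hG using 2
    · simp only [Pi.add_apply, Finset.sum_add_distrib, mul_add]
    · rw [← mul_add, ← integral_add (integrable_of_mem_convexStepFunctions hF')
        (integrable_of_mem_convexStepFunctions hG')]
      rfl
  | smul c F _ hF =>
    convert hF.const_mul c using 2
    · simp only [Pi.smul_apply, smul_eq_mul, ← Finset.mul_sum]; ring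
    · simp only [Pi.smul_apply, smul_eq_mul, integral_const_mul]; ring

/-! ### Pulling step functions back along the flow -/

theorem rotateSquare_mem (d x : ℝ × ℝ) :
    rotateSquare d x ∈ Set.Ico (0 : ℝ) 1 ×ˢ Set.Ico (0 : ℝ) 1 :=
  ⟨⟨Int.fract_nonneg _, Int.fract_lt_one _⟩, ⟨Int.fract_nonneg _, Int.fract_lt_one _⟩⟩

open Classical in
/-- The part of `[0,1)²` on which the flow by `d` crosses `a` vertical and `b` horizontal edges, in
the order told by `o`, and ends in `C`. -/
def crossPiece (d : ℝ × ℝ) (o : Bool) (a b : ℤ) (C : Set (ℝ × ℝ)) : Set (ℝ × ℝ) :=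
  (Set.Ico 0 1 ×ˢ Set.Ico 0 1) ∩
    (({x | decide (crossTime d.1 x.1 < crossTime d.2 x.2) = o} ∩
    (Set.Ico (a - d.1) (a + 1 - d.1) ×ˢ Set.Ico (b - d.2) (b + 1 - d.2))) ∩
      (fun x => (d - (((a : ℝ), (b : ℝ)) : ℝ × ℝ)) + x) ⁻¹' C)

/-- Crossing times are affine in the position, so their order cuts out a half-plane; prescribed
floors cut out a box, and on it the flow is a single translation. -/
theorem convex_crossPiece (d : ℝ × ℝ) (o : Bool) (a b : ℤ) {C : Set (ℝ × ℝ)} (hC : Convex ℝ C) :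
    Convex ℝ (crossPiece d o a b C) := by
  refine ((convex_Ico _ _).prod (convex_Ico _ _)).inter ((Convex.inter ?_
    ((convex_Ico _ _).prod (convex_Ico _ _))).inter (hC.translate_preimage_right _))
  have hlin : IsLinearMap ℝ fun x : ℝ × ℝ => x.2 / d.2 - x.1 / d.1 :=
    ⟨fun x y => by simp; ring, fun c x => by simp; ring⟩
  have key : ∀ x : ℝ × ℝ, crossTime d.1 x.1 < crossTime d.2 x.2 ↔
      x.2 / d.2 - x.1 / d.1 < (if 0 < d.2 then 1 else 0) / d.2 - (if 0 < d.1 then 1 else 0) / d.1 := by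
    intro x
    simp only [crossTime, sub_div]
    constructor <;> intro h <;> linarith
  cases o
  · simp only [decide_eq_false_iff_not, key, not_lt]
    exact convex_halfSpace_ge hlin _
  · simp only [decide_eq_true_eq, key]
    exact convex_halfSpace_lt hlin _

theorem measurableSet_crossPiece (d : ℝ × ℝ) (o : Bool) (a b : ℤ) {C : Set (ℝ × ℝ)}
    (hC : MeasurableSet C) : MeasurableSet (crossPiece d o a b C) := by
  refine (measurableSet_Ico.prod measurableSet_Ico).inter ((MeasurableSet.inter ?_
    (measurableSet_Ico.prod measurableSet_Ico)).inter ((measurable_const_add _) hC))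
  have hm : MeasurableSet {x : ℝ × ℝ | crossTime d.1 x.1 < crossTime d.2 x.2} :=
    measurableSet_lt ((measurable_crossTime _).comp measurable_fst)
      ((measurable_crossTime _).comp measurable_snd)
  cases o
  · simp only [decide_eq_false_iff_not]
    exact hm.compl
  · simpa only [decide_eq_true_eq]

open Classical in
theorem mem_crossPiece {d x : ℝ × ℝ} {o : Bool} {a b : ℤ} {C : Set (ℝ × ℝ)}
    (hx : x ∈ Set.Ico (0 : ℝ) 1 ×ˢ Set.Ico (0 : ℝ) 1) :
    x ∈ crossPiece d o a b C ↔ (decide (crossTime d.1 x.1 < crossTime d.2 x.2) = o ∧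
      ⌊x.1 + d.1⌋ = a ∧ ⌊x.2 + d.2⌋ = b) ∧ rotateSquare d x ∈ C := by
  have hfl : ∀ (y e : ℝ) (n : ℤ), y ∈ Set.Ico (n - e) (n + 1 - e) ↔ ⌊y + e⌋ = n := by
    intro y e n
    rw [Int.floor_eq_iff, Set.mem_Ico]
    constructor <;> rintro ⟨h1, h2⟩ <;> constructor <;> linarith
  simp only [crossPiece, Set.mem_inter_iff, hx, true_and, Set.mem_prod, hfl, Set.mem_ofPred_eq,
    Set.mem_preimage]
  refine and_congr_right ?_
  rintro ⟨-, rfl, rfl⟩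
  have : d - (((⌊x.1 + d.1⌋ : ℤ) : ℝ), ((⌊x.2 + d.2⌋ : ℤ) : ℝ)) + x = rotateSquare d x := by
    ext
    · simp only [rotateSquare, Int.fract, Prod.fst_add, Prod.fst_sub]; ring
    · simp only [rotateSquare, Int.fract, Prod.snd_add, Prod.snd_sub]; ring
  rw [this]

namespace PolysquareSurface

variable {σ : Type*} (P : PolysquareSurface σ)

theorem floor_add_mem_Icc {x d : ℝ} (hx : x ∈ Set.Ico (0 : ℝ) 1) (hd : |d| < 1) :
    ⌊x + d⌋ ∈ Finset.Icc (-1 : ℤ) 1 := by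
  obtain ⟨h1, h2⟩ := abs_lt.1 hd
  rw [Finset.mem_Icc]
  constructor
  · rw [Int.le_floor]; push_cast; linarith [hx.1]
  · rw [← Int.lt_add_one_iff, Int.floor_lt]; push_cast; linarith [hx.2]

-- A displacement with coordinates below 1 has finitely many combinatorial types (order of crossing,
-- two floors, starting square), and each type contributes one convex piece. The outer indicator
-- removes points outside the unit square, which `stepMap` also sends into it.
open Classical in
theorem comp_stepMap_mem_convexStepFunctions [Fintype σ] {d : ℝ × ℝ} (hd1 : |d.1| < 1)
    (hd2 : |d.2| < 1) {F : (ℝ × ℝ) × σ → ℂ} (hF : F ∈ convexStepFunctions σ) :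
    ((Set.Ico 0 1 ×ˢ Set.Ico 0 1) ×ˢ Set.univ).indicator (F ∘ P.stepMap d) ∈
      convexStepFunctions σ := by
  induction hF using Submodule.span_induction with
  | zero =>
    convert Submodule.zero_mem (convexStepFunctions σ) using 1
    ext p
    simp [Set.indicator]
  | add F G _ _ hF hG =>
    convert Submodule.add_mem _ hF hG using 1
    exact Set.indicator_add _ _ _
  | smul c F _ hF =>
    convert Submodule.smul_mem _ c hF using 1
    exact Set.indicator_const_smul _ c _
  | mem F h =>
    obtain ⟨C, i, hC, hm, hQ, rfl⟩ := h
    let I : Finset ((Bool × ℤ × ℤ) × σ) :=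
      (Finset.univ ×ˢ Finset.Icc (-1) 1 ×ˢ Finset.Icc (-1) 1) ×ˢ Finset.univ
    let G : (Bool × ℤ × ℤ) × σ → (ℝ × ℝ) × σ → ℂ := fun q =>
      if P.crossPerm (q.1.1 = true) q.1.2.1 q.1.2.2 q.2 = i then
        (crossPiece d q.1.1 q.1.2.1 q.1.2.2 C ×ˢ {q.2}).indicator 1 else 0
    have hG : ∑ q ∈ I, G q ∈ convexStepFunctions σ := by
      refine Submodule.sum_mem _ fun q _ => ?_
      simp only [G]
      split_ifs
      · exact indicator_mem_convexStepFunctions _ (convex_crossPiece _ _ _ _ hC)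
          (measurableSet_crossPiece _ _ _ _ hm) Set.inter_subset_left
      · exact Submodule.zero_mem _
    convert hG using 1
    ext ⟨x, j⟩
    rw [Finset.sum_apply]
    by_cases hx : x ∈ Set.Ico (0 : ℝ) 1 ×ˢ Set.Ico (0 : ℝ) 1
    · rw [Set.indicator_of_mem (show (x, j) ∈ _ ×ˢ _ from ⟨hx, Set.mem_univ _⟩)]
      -- A given point has exactly one combinatorial type.
      rw [Finset.sum_eq_single
        ((decide (crossTime d.1 x.1 < crossTime d.2 x.2), ⌊x.1 + d.1⌋, ⌊x.2 + d.2⌋), j)]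
      · have hperm : P.crossPerm (decide (crossTime d.1 x.1 < crossTime d.2 x.2) = true)
            ⌊x.1 + d.1⌋ ⌊x.2 + d.2⌋ j = (P.stepMap d (x, j)).2 := by
          simp [stepMap, crossPerm]
        simp only [G, hperm]
        by_cases hs : (P.stepMap d (x, j)).2 = i
        · rw [if_pos hs]
          by_cases hC' : rotateSquare d x ∈ C
          · have h1 : P.stepMap d (x, j) ∈ C ×ˢ {i} := ⟨hC', hs⟩
            have h2 : (x, j) ∈ crossPiece d (decide (crossTime d.1 x.1 < crossTime d.2 x.2))
                ⌊x.1 + d.1⌋ ⌊x.2 + d.2⌋ C ×ˢ ({j} : Set σ) :=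
              ⟨(mem_crossPiece hx).2 ⟨⟨rfl, rfl, rfl⟩, hC'⟩, rfl⟩
            rw [Set.indicator_of_mem h2, Function.comp_apply, Set.indicator_of_mem h1]
            rfl
          · rw [Set.indicator_of_notMem (fun h => hC' ((mem_crossPiece hx).1 h.1).2),
              Function.comp_apply, Set.indicator_of_notMem (fun h => hC' h.1)]
        · rw [if_neg hs, Function.comp_apply, Set.indicator_of_notMem (fun h => hs h.2)]
          rfl
      · intro q _ hq
        simp only [G]
        split_ifs
        · refine Set.indicator_of_notMem (fun h => hq ?_) _
          obtain ⟨⟨h1, h2, h3⟩, -⟩ := (mem_crossPiece hx).1 h.1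
          have h4 : j = q.2 := h.2
          obtain ⟨⟨_, _, _⟩, _⟩ := q
          simp only at h1 h2 h3 h4
          subst h1 h2 h3 h4
          rfl
        · rfl
      · intro h
        refine absurd ?_ h
        simp only [I, Finset.mem_product, Finset.mem_univ, true_and, and_true]
        exact ⟨floor_add_mem_Icc hx.1 hd1, floor_add_mem_Icc hx.2 hd2⟩
    · rw [Set.indicator_of_notMem (fun h => hx h.1)]
      symm
      refine Finset.sum_eq_zero fun q _ => ?_
      simp only [G]
      split_ifs
      · exact Set.indicator_of_notMem (fun h => hx h.1.1) _
      · rfl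

theorem comp_iterate_mem_convexStepFunctions [Fintype σ] {d : ℝ × ℝ} (hd1 : |d.1| < 1)
    (hd2 : |d.2| < 1) {F : (ℝ × ℝ) × σ → ℂ} (hF : F ∈ convexStepFunctions σ) (n : ℕ) :
    ((Set.Ico 0 1 ×ˢ Set.Ico 0 1) ×ˢ Set.univ).indicator (F ∘ (P.stepMap d)^[n]) ∈
      convexStepFunctions σ := by
  induction n with
  | zero =>
    convert hF using 1
    rw [Function.iterate_zero, Function.comp_id]
    exact Set.indicator_eq_self.2 (support_subset_of_mem_convexStepFunctions hF)
  | succ n ih =>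
    convert P.comp_stepMap_mem_convexStepFunctions hd1 hd2 ih using 1
    ext p
    by_cases hp : p ∈ ((Set.Ico (0 : ℝ) 1 ×ˢ Set.Ico (0 : ℝ) 1) ×ˢ (Set.univ : Set σ))
    · rw [Set.indicator_of_mem hp, Set.indicator_of_mem hp, Function.comp_apply,
        Function.comp_apply, Set.indicator_of_mem (show P.stepMap d p ∈ _ ×ˢ _ from
          ⟨rotateSquare_mem _ _, Set.mem_univ _⟩), Function.comp_apply,
          Function.iterate_succ_apply]
    · rw [Set.indicator_of_notMem hp, Set.indicator_of_notMem hp]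

end PolysquareSurface

/-! ### Geodesics as orbits -/

/-- A path that moves locally with velocity `w` modulo one does so globally. -/
theorem eq_unitFract_of_eventually {x : ℝ≥0 → Set.Ico (0 : ℝ) 1} {w : ℝ}
    (h : ∀ t, ∀ᶠ s in 𝓝 t, x s = unitFract (x t + ((s : ℝ) - (t : ℝ)) * w)) (s t : ℝ≥0) :
    x s = unitFract (x t + ((s : ℝ) - (t : ℝ)) * w) := by
  -- Removing the linear motion leaves a locally constant function on a connected space.
  let f : ℝ≥0 → UnitAddCircle := fun t => ((x t : ℝ) : UnitAddCircle) - ((t * w : ℝ) : UnitAddCircle)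
  have hf : IsLocallyConstant f := by
    rw [IsLocallyConstant.iff_eventually_eq]
    intro t
    filter_upwards [h t] with s hs
    simp only [f, hs, unitFract, coe_fract_unitAddCircle]
    rw [← AddCircle.coe_sub, ← AddCircle.coe_sub]
    congr 1
    ring
  have h1 : f s = f t := hf.apply_eq_of_preconnectedSpace s t
  have h2 : ((x s : ℝ) : UnitAddCircle) =
      ((x t + ((s : ℝ) - (t : ℝ)) * w : ℝ) : UnitAddCircle) := by
    simp only [f] at h1
    rw [sub_eq_iff_eq_add] at h1
    rw [h1, ← AddCircle.coe_sub, ← AddCircle.coe_add]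
    congr 1
    ring
  ext
  have h3 := coe_equivIco_coe (x s)
  rw [h2, coe_equivIco_coe, Int.fract_eq_self.2 (x s).2] at h3
  exact h3.symm

theorem floor_add_mul_of_lt_crossTime {d x u : ℝ} (hd : d ≠ 0) (hx : x ∈ Set.Ico (0 : ℝ) 1)
    (hu0 : 0 ≤ u) (hu : u < crossTime d x) : ⌊x + u * d⌋ = 0 := by
  rw [Int.floor_eq_zero_iff]
  unfold crossTime at hu
  rcases hd.lt_or_gt with h | h
  · rw [if_neg h.not_gt, lt_div_iff_of_neg h] at hu
    constructor
    · linarith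
    · nlinarith [hx.2]
  · rw [if_pos h, lt_div_iff₀ h] at hu
    constructor
    · nlinarith [hx.1]
    · linarith

/-- With |d| < 1 there is no second crossing up to time 1. The crossing instant itself is left out,
since the floor there depends on the sign of d. -/
theorem floor_add_mul_of_crossTime_lt {d x u : ℝ} (hd : d ≠ 0) (hd1 : |d| < 1)
    (hx : x ∈ Set.Ico (0 : ℝ) 1) (hu0 : 0 ≤ u) (hu1 : u ≤ 1) (hu : crossTime d x < u) :
    ⌊x + u * d⌋ = if 0 < d then 1 else -1 := by
  obtain ⟨h1, h2⟩ := abs_lt.1 hd1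
  unfold crossTime at hu
  rcases hd.lt_or_gt with h | h
  · rw [if_neg h.not_gt] at hu ⊢
    rw [div_lt_iff_of_neg h] at hu
    rw [Int.floor_eq_iff]
    push_cast
    constructor
    · nlinarith [hx.1]
    · linarith
  · rw [if_pos h] at hu ⊢
    rw [div_lt_iff₀ h] at hu
    rw [Int.floor_eq_iff]
    push_cast
    constructor
    · linarith
    · nlinarith [hx.2]

theorem fract_add_crossTime_mul {d x : ℝ} (hd : d ≠ 0) : Int.fract (x + crossTime d x * d) = 0 := by
  rw [crossTime, div_mul_cancel₀ _ hd, add_sub_cancel]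
  split_ifs <;> simp

theorem eventually_floor_eq_of_crossTime_lt {d x u₀ : ℝ} (hd : d ≠ 0) (hd1 : |d| < 1)
    (hx : x ∈ Set.Ico (0 : ℝ) 1) (hu₀ : u₀ ∈ Set.Icc (0 : ℝ) 1) (h : crossTime d x < u₀) :
    ∀ᶠ u in 𝓝[Set.Icc 0 1] u₀, ⌊x + u * d⌋ = ⌊x + u₀ * d⌋ := by
  filter_upwards [self_mem_nhdsWithin, mem_nhdsWithin_of_mem_nhds (lt_mem_nhds h)] with u hu h1
  rw [floor_add_mul_of_crossTime_lt hd hd1 hx hu.1 hu.2 h1,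
    floor_add_mul_of_crossTime_lt hd hd1 hx hu₀.1 hu₀.2 h]

theorem eventually_floor_eq_zero_of_lt_crossTime {d x u₀ : ℝ} (hd : d ≠ 0)
    (hx : x ∈ Set.Ico (0 : ℝ) 1) (h : u₀ < crossTime d x) :
    ∀ᶠ u in 𝓝[Set.Icc 0 1] u₀, ⌊x + u * d⌋ = 0 := by
  filter_upwards [self_mem_nhdsWithin, mem_nhdsWithin_of_mem_nhds (gt_mem_nhds h)] with u hu h1
  exact floor_add_mul_of_lt_crossTime hd hx hu.1 h1

namespace PolysquareSurface

variable {σ : Type*} (P : PolysquareSurface σ)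

-- The crossing permutation obeys the same local law as the square of a geodesic. The fixed order of
-- `right` and `up` in the chart does no harm, because away from vertices at most one of the two
-- floors changes near a given time.
open Classical in
theorem eventually_crossPerm_eq {d x : ℝ × ℝ} (hd1 : d.1 ≠ 0) (hd2 : d.2 ≠ 0) (hs1 : |d.1| < 1)
    (hs2 : |d.2| < 1) (hx : x ∈ Set.Ico (0 : ℝ) 1 ×ˢ Set.Ico (0 : ℝ) 1) {u₀ : ℝ}
    (hu₀ : u₀ ∈ Set.Icc (0 : ℝ) 1)
    (hcorner : ¬(Int.fract (x.1 + u₀ * d.1) = 0 ∧ Int.fract (x.2 + u₀ * d.2) = 0)) :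
    ∀ᶠ u in 𝓝[Set.Icc 0 1] u₀,
      P.crossPerm (crossTime d.1 x.1 < crossTime d.2 x.2) ⌊x.1 + u * d.1⌋ ⌊x.2 + u * d.2⌋ =
        P.right ^ (⌊x.1 + u * d.1⌋ - ⌊x.1 + u₀ * d.1⌋) *
          P.up ^ (⌊x.2 + u * d.2⌋ - ⌊x.2 + u₀ * d.2⌋) *
          P.crossPerm (crossTime d.1 x.1 < crossTime d.2 x.2)
            ⌊x.1 + u₀ * d.1⌋ ⌊x.2 + u₀ * d.2⌋ := by
  unfold crossPerm
  by_cases ho : crossTime d.1 x.1 < crossTime d.2 x.2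
  · simp only [if_pos ho]
    rcases lt_or_ge (crossTime d.1 x.1) u₀ with h | h
    · filter_upwards [eventually_floor_eq_of_crossTime_lt hd1 hs1 hx.1 hu₀ h] with u hu
      rw [hu, sub_self, zpow_zero, one_mul, ← mul_assoc, ← zpow_add, sub_add_cancel]
    · have h' := h.trans_lt ho
      have h0 := floor_add_mul_of_lt_crossTime hd2 hx.2 hu₀.1 h'
      filter_upwards [eventually_floor_eq_zero_of_lt_crossTime hd2 hx.2 h'] with u hu
      rw [hu, h0, sub_self, zpow_zero, one_mul, mul_one, one_mul, ← zpow_add, sub_add_cancel]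
  · simp only [if_neg ho]
    -- Otherwise both crossings occur exactly at time u₀, which is a vertex. Ties belong to this
    -- branch, the only one that needs `hcorner`.
    have hcase : crossTime d.2 x.2 < u₀ ∨ u₀ < crossTime d.1 x.1 := by
      by_contra! hne
      obtain ⟨h1, h2⟩ := hne
      have e1 : crossTime d.1 x.1 = u₀ := le_antisymm h2 (h1.trans (not_lt.1 ho))
      have e2 : crossTime d.2 x.2 = u₀ := le_antisymm ((not_lt.1 ho).trans h2) h1
      apply hcorner
      nth_rewrite 1 [← e1]
      rw [← e2]
      exact ⟨fract_add_crossTime_mul hd1, fract_add_crossTime_mul hd2⟩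
    rcases hcase with h | h
    · filter_upwards [eventually_floor_eq_of_crossTime_lt hd2 hs2 hx.2 hu₀ h] with u hu
      rw [hu, sub_self, zpow_zero, mul_one, ← mul_assoc, ← zpow_add, sub_add_cancel]
    · have h0 := floor_add_mul_of_lt_crossTime hd1 hx.1 hu₀.1 h
      filter_upwards with u
      rw [h0, sub_zero, zpow_zero, one_mul, mul_assoc, ← zpow_add, sub_add_cancel]

-- Since i(u) and the crossing permutation `W u` obey the same local law, (W u)⁻¹ i(u) is locally
-- constant on [0,1], and W 0 is the identity.
open Classical in
theorem eq_crossPerm_of_eventually {d x : ℝ × ℝ} (hd1 : d.1 ≠ 0) (hd2 : d.2 ≠ 0) (hs1 : |d.1| < 1)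
    (hs2 : |d.2| < 1) (hx : x ∈ Set.Ico (0 : ℝ) 1 ×ˢ Set.Ico (0 : ℝ) 1)
    (hcorner : ∀ u ∈ Set.Icc (0 : ℝ) 1,
      ¬(Int.fract (x.1 + u * d.1) = 0 ∧ Int.fract (x.2 + u * d.2) = 0))
    (i : ℝ → σ)
    (hi : ∀ u₀ ∈ Set.Icc (0 : ℝ) 1, ∀ᶠ u in 𝓝[Set.Icc 0 1] u₀,
      i u = (P.right ^ (⌊x.1 + u * d.1⌋ - ⌊x.1 + u₀ * d.1⌋))
        ((P.up ^ (⌊x.2 + u * d.2⌋ - ⌊x.2 + u₀ * d.2⌋)) (i u₀))) :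
    i 1 = P.crossPerm (crossTime d.1 x.1 < crossTime d.2 x.2) ⌊x.1 + d.1⌋ ⌊x.2 + d.2⌋ (i 0) := by
  let W : ℝ → Equiv.Perm σ := fun u =>
    P.crossPerm (crossTime d.1 x.1 < crossTime d.2 x.2) ⌊x.1 + u * d.1⌋ ⌊x.2 + u * d.2⌋
  let k : Set.Icc (0 : ℝ) 1 → σ := fun u => (W u)⁻¹ (i u)
  have hk : IsLocallyConstant k := by
    rw [IsLocallyConstant.iff_eventually_eq]
    rintro ⟨u₀, hu₀⟩
    have h1 := P.eventually_crossPerm_eq hd1 hd2 hs1 hs2 hx hu₀ (hcorner u₀ hu₀)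
    have h2 := h1.and (hi u₀ hu₀)
    rw [← map_nhds_subtype_val ⟨u₀, hu₀⟩, eventually_map] at h2
    filter_upwards [h2] with u hu
    simp only [k, W]
    rw [hu.1, hu.2, Equiv.Perm.inv_eq_iff_eq]
    simp
  have h := hk.apply_eq_of_preconnectedSpace ⟨1, by simp⟩ ⟨0, by simp⟩
  have hW0 : W 0 = 1 := by
    simp only [W, zero_mul, add_zero, Int.floor_eq_zero_iff.2 hx.1, Int.floor_eq_zero_iff.2 hx.2]
    simp [crossPerm]
  simp only [k, hW0, inv_one, Equiv.Perm.one_apply] at h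
  rw [Equiv.Perm.inv_eq_iff_eq] at h
  rw [h]
  simp only [W, one_mul]

/-- The coordinates of a point in the plane, together with its square. -/
def coords {P : PolysquareSurface σ} (p : P.Point) : (ℝ × ℝ) × σ :=
  (((p.2.1 : ℝ), (p.2.2 : ℝ)), p.1)

variable {P}

theorem IsGeodesic.fst_eq {v : ℝ × ℝ} {L : ℝ≥0 → P.Point} (hL : P.IsGeodesic v L) (s t : ℝ≥0) :
    ((L s).2.1 : ℝ) = Int.fract ((L t).2.1 + ((s : ℝ) - t) * v.1) := by
  have := eq_unitFract_of_eventually (x := fun t => (L t).2.1) (w := v.1) (fun t => by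
    filter_upwards [hL.2 t] with s hs
    rw [hs]; rfl) s t
  exact congrArg Subtype.val this

theorem IsGeodesic.snd_eq {v : ℝ × ℝ} {L : ℝ≥0 → P.Point} (hL : P.IsGeodesic v L) (s t : ℝ≥0) :
    ((L s).2.2 : ℝ) = Int.fract ((L t).2.2 + ((s : ℝ) - t) * v.2) := by
  have := eq_unitFract_of_eventually (x := fun t => (L t).2.2) (w := v.2) (fun t => by
    filter_upwards [hL.2 t] with s hs
    rw [hs]; rfl) s t
  exact congrArg Subtype.val this

theorem floor_fract_add (z e : ℝ) : ⌊Int.fract z + e⌋ = ⌊z + e⌋ - ⌊z⌋ := by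
  rw [Int.fract, sub_add_eq_add_sub, Int.floor_sub_intCast]

/-- A geodesic that does not meet the vertices is followed by `stepMap`. -/
theorem IsGeodesic.coords_add_eq_stepMap {v : ℝ × ℝ} {L : ℝ≥0 → P.Point} (hL : P.IsGeodesic v L)
    (hv1 : v.1 ≠ 0) (hv2 : v.2 ≠ 0) {ε : ℝ≥0} (hε : 0 < ε) (hs1 : |ε * v.1| < 1)
    (hs2 : |ε * v.2| < 1) (t : ℝ≥0)
    (hcorner : ∀ s, t ≤ s → ¬(((L s).2.1 : ℝ) = 0 ∧ ((L s).2.2 : ℝ) = 0)) :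
    coords (L (t + ε)) = P.stepMap ((ε : ℝ) • v) (coords (L t)) := by
  have hεR : (ε : ℝ) ≠ 0 := by positivity
  -- Parametrises the time interval from t to t + ε by [0,1].
  let τ : ℝ → ℝ≥0 := fun u => t + u.toNNReal * ε
  have hτ : Continuous τ := by fun_prop
  have hτR : ∀ u : ℝ, 0 ≤ u → ((τ u : ℝ≥0) : ℝ) = t + u * ε := fun u hu => by
    simp [τ, Real.coe_toNNReal u hu]
  have hpos1 : ∀ u : ℝ, 0 ≤ u →
      ((L (τ u)).2.1 : ℝ) = Int.fract (((L t).2.1 : ℝ) + u * ((ε : ℝ) • v).1) := fun u hu => by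
    rw [hL.fst_eq (τ u) t, hτR u hu, Prod.smul_fst, smul_eq_mul]
    congr 1; ring
  have hpos2 : ∀ u : ℝ, 0 ≤ u →
      ((L (τ u)).2.2 : ℝ) = Int.fract (((L t).2.2 : ℝ) + u * ((ε : ℝ) • v).2) := fun u hu => by
    rw [hL.snd_eq (τ u) t, hτR u hu, Prod.smul_snd, smul_eq_mul]
    congr 1; ring
  have hτ1 : τ 1 = t + ε := by simp [τ]
  have hτ0 : τ 0 = t := by simp [τ]
  have key := P.eq_crossPerm_of_eventually (d := (ε : ℝ) • v) (x := (coords (L t)).1)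
    (mul_ne_zero hεR hv1) (mul_ne_zero hεR hv2) hs1 hs2 ⟨(L t).2.1.2, (L t).2.2.2⟩
    (fun u hu => by
      have := hcorner (τ u) (by simp [τ])
      rwa [hpos1 u hu.1, hpos2 u hu.1] at this)
    (fun u => (L (τ u)).1) (fun u₀ hu₀ => by
      have h1 := (hτ.tendsto u₀).eventually (hL.2 (τ u₀))
      filter_upwards [mem_nhdsWithin_of_mem_nhds h1, self_mem_nhdsWithin] with u hu hu'
      have hsub : ((τ u : ℝ≥0) : ℝ) - τ u₀ = (u - u₀) * ε := by
        rw [hτR u hu'.1, hτR u₀ hu₀.1]; ring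
      rw [hu, hsub]
      simp only [translate]
      -- Exponents in the chart at `τ u₀` become differences of floors counted from the starting
      -- point.
      rw [hpos1 u₀ hu₀.1, hpos2 u₀ hu₀.1, floor_fract_add, floor_fract_add]
      simp only [coords, Prod.smul_fst, Prod.smul_snd, smul_eq_mul]
      have e : ∀ z y : ℝ, z + u₀ * (ε * y) + (u - u₀) * ε * y = z + u * (ε * y) := by
        intro z y; ring
      rw [e, e])
  have h1 := hpos1 1 zero_le_one
  have h2 := hpos2 1 zero_le_one
  rw [one_mul, hτ1] at h1 h2
  rw [hτ1, hτ0] at key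
  exact Prod.ext (Prod.ext h1 h2) key

theorem IsGeodesic.coords_add_one_eq_iterate {v : ℝ × ℝ} {L : ℝ≥0 → P.Point}
    (hL : P.IsGeodesic v L) (hv1 : v.1 ≠ 0) (hv2 : v.2 ≠ 0) {N : ℕ} (hN : N ≠ 0)
    (hs1 : |(N : ℝ)⁻¹ * v.1| < 1) (hs2 : |(N : ℝ)⁻¹ * v.2| < 1) (t : ℝ≥0)
    (hcorner : ∀ s, t ≤ s → ¬(((L s).2.1 : ℝ) = 0 ∧ ((L s).2.2 : ℝ) = 0)) :
    coords (L (t + 1)) = (P.stepMap ((N : ℝ)⁻¹ • v))^[N] (coords (L t)) := by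
  have h : ∀ n : ℕ, coords (L (t + n * (N : ℝ≥0)⁻¹)) =
      (P.stepMap ((N : ℝ)⁻¹ • v))^[n] (coords (L t)) := by
    intro n
    induction n with
    | zero => simp
    | succ n ih =>
      rw [Function.iterate_succ_apply', ← ih]
      have := hL.coords_add_eq_stepMap hv1 hv2 (ε := (N : ℝ≥0)⁻¹) (by positivity)
        (by simpa using hs1) (by simpa using hs2) (t + n * (N : ℝ≥0)⁻¹)
        (fun s hs => hcorner s (le_self_add.trans hs))
      rw [add_assoc] at this
      push_cast at this ⊢
      rw [← this]
      congr 3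
      ring
  have := h N
  rwa [mul_inv_cancel₀ (by exact_mod_cast hN)] at this

/-- Two visits to vertices, even nonsingular ones, at distance T > 0 in time would make Tv₁ = a and
Tv₂ = b integers, so b·v₁ − a·v₂ = 0. At most one vertex is met, and it can be left behind. -/
theorem exists_nat_forall_not_vertex {v : ℝ × ℝ} (hv : IsKroneckerVector₂ v)
    {L : ℝ≥0 → P.Point} (hL : P.IsGeodesic v L) :
    ∃ n : ℕ, ∀ s : ℝ≥0, n ≤ s → ¬(((L s).2.1 : ℝ) = 0 ∧ ((L s).2.2 : ℝ) = 0) := by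
  by_cases h : ∃ t, ((L t).2.1 : ℝ) = 0 ∧ ((L t).2.2 : ℝ) = 0
  · obtain ⟨t, ht1, ht2⟩ := h
    obtain ⟨n, hn⟩ := exists_nat_gt t
    refine ⟨n, fun s hs ⟨h1, h2⟩ => ?_⟩
    have hst : (0 : ℝ) < s - t := sub_pos.2 (by exact_mod_cast hn.trans_le hs)
    rw [hL.fst_eq s t, ht1, zero_add, Int.fract_eq_zero_iff] at h1
    rw [hL.snd_eq s t, ht2, zero_add, Int.fract_eq_zero_iff] at h2
    obtain ⟨a, ha⟩ := h1
    obtain ⟨b, hb⟩ := h2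
    have hlin := Fintype.linearIndependent_iff.1 hv ![(b : ℚ), -(a : ℚ), 0] (by
      simp only [Fin.sum_univ_three, Matrix.cons_val_zero, Matrix.cons_val_one, Matrix.cons_val_two,
        Matrix.head_cons, Matrix.tail_cons, Rat.smul_def]
      push_cast
      rw [ha, hb]
      simp
      ring)
    have hb0 : b = 0 := by simpa using hlin 0
    have hv2 : v.2 = 0 := by
      rw [hb0, Int.cast_zero] at hb
      exact (mul_eq_zero.1 hb.symm).resolve_left hst.ne'
    exact hv.ne_zero 1 (by simpa using hv2)
  · push Not at h
    exact ⟨0, fun s _ hs => h s hs.1 hs.2⟩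

end PolysquareSurface

/-! ### Twisted averages along orbits -/

/-- Averages of a bounded sequence tend to zero if its short averages are small in mean square. -/
theorem tendsto_average_zero_of_short_averages (c : ℕ → ℂ) (hc : ∀ j, ‖c j‖ ≤ 1)
    (h : ∀ ε > 0, ∃ H : ℕ, H ≠ 0 ∧ ∀ᶠ J : ℕ in atTop, (J : ℝ)⁻¹ *
      ∑ j ∈ Finset.range J, ‖(H : ℂ)⁻¹ * ∑ k ∈ Finset.range H, c (j + k)‖ ^ 2 < ε) :
    Tendsto (fun J : ℕ => (J : ℂ)⁻¹ * ∑ j ∈ Finset.range J, c j) atTop (𝓝 0) := by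
  have hsum : ∀ a n : ℕ, ‖∑ j ∈ Finset.range n, c (a + j)‖ ≤ n := fun a n => by
    simpa using norm_sum_le_of_le (Finset.range n) (fun j _ => hc (a + j))
  rw [tendsto_zero_iff_norm_tendsto_zero]
  rw [Metric.tendsto_atTop']
  intro ε hε
  -- Squared because Cauchy–Schwarz returns a square root; the other ε/2 absorbs the boundary terms
  -- 2H/J.
  obtain ⟨H, hH, hev⟩ := h ((ε / 2) ^ 2) (by positivity)
  have hev2 : ∀ᶠ J : ℕ in atTop, 2 * (H : ℝ) / J < ε / 2 :=
    (tendsto_const_div_atTop_nhds_zero_nat (2 * (H : ℝ))).eventually (gt_mem_nhds (by positivity))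
  obtain ⟨J₀, hJ₀⟩ := eventually_atTop.1 (hev.and (hev2.and (eventually_gt_atTop 0)))
  refine ⟨J₀, fun J hJ => ?_⟩
  obtain ⟨h1, h2, hJpos⟩ := hJ₀ J hJ.le
  have hJR : (0 : ℝ) < J := by exact_mod_cast hJpos
  have hHR : (0 : ℝ) < H := by exact_mod_cast Nat.pos_of_ne_zero hH
  let A : ℕ → ℂ := fun j => (H : ℂ)⁻¹ * ∑ k ∈ Finset.range H, c (j + k)
  -- A shift by k changes only k terms at each end of the sum.
  have hshift : ∀ k ∈ Finset.range H,
      ‖∑ j ∈ Finset.range J, c j - ∑ j ∈ Finset.range J, c (j + k)‖ ≤ 2 * (H : ℝ) := by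
    intro k hk
    have e1 := Finset.sum_range_add c k J
    have e2 := Finset.sum_range_add c J k
    rw [add_comm k J, e2] at e1
    have e3 : ∑ j ∈ Finset.range J, c j - ∑ j ∈ Finset.range J, c (j + k) =
        ∑ j ∈ Finset.range k, c (0 + j) - ∑ j ∈ Finset.range k, c (J + j) := by
      simp only [add_comm _ k, zero_add]
      linear_combination e1
    rw [e3]
    have hkH : (k : ℝ) ≤ H := by exact_mod_cast (Finset.mem_range.1 hk).le
    linarith [norm_sub_le (∑ j ∈ Finset.range k, c (0 + j)) (∑ j ∈ Finset.range k, c (J + j)),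
      hsum 0 k, hsum J k]
  have hdiff : ‖∑ j ∈ Finset.range J, c j - ∑ j ∈ Finset.range J, A j‖ ≤ 2 * H := by
    have e : ∑ j ∈ Finset.range J, c j - ∑ j ∈ Finset.range J, A j = (H : ℂ)⁻¹ *
        ∑ k ∈ Finset.range H, (∑ j ∈ Finset.range J, c j - ∑ j ∈ Finset.range J, c (j + k)) := by
      simp only [A]
      rw [← Finset.mul_sum, Finset.sum_comm, Finset.sum_sub_distrib, Finset.sum_const,
        Finset.card_range, nsmul_eq_mul, mul_sub, inv_mul_cancel_left₀ (by exact_mod_cast hH)]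
    rw [e, norm_mul, norm_inv, Complex.norm_natCast, inv_mul_le_iff₀ hHR]
    simpa using norm_sum_le_of_le _ hshift
  have hCS : ‖∑ j ∈ Finset.range J, A j‖ ≤ J * (ε / 2) := by
    have e1 : (∑ j ∈ Finset.range J, ‖A j‖) ^ 2 ≤ J * ∑ j ∈ Finset.range J, ‖A j‖ ^ 2 := by
      simpa using sq_sum_le_card_mul_sum_sq (s := Finset.range J) (f := fun j => ‖A j‖)
    have e2 : ∑ j ∈ Finset.range J, ‖A j‖ ^ 2 < J * (ε / 2) ^ 2 := by
      rwa [inv_mul_lt_iff₀ hJR] at h1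
    have e3 : (∑ j ∈ Finset.range J, ‖A j‖) ^ 2 ≤ (J * (ε / 2)) ^ 2 := by
      refine e1.trans ?_
      rw [mul_pow, sq (J : ℝ), mul_assoc]
      exact mul_le_mul_of_nonneg_left e2.le hJR.le
    exact (norm_sum_le _ _).trans (abs_le_of_sq_le_sq' e3 (by positivity)).2
  rw [Real.dist_0_eq_abs, abs_norm, norm_mul, norm_inv, Complex.norm_natCast,
    inv_mul_lt_iff₀ hJR]
  rw [div_lt_iff₀ hJR] at h2
  calc ‖∑ j ∈ Finset.range J, c j‖
      ≤ ‖∑ j ∈ Finset.range J, c j - ∑ j ∈ Finset.range J, A j‖ + ‖∑ j ∈ Finset.range J, A j‖ := by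
        simpa using norm_add_le (∑ j ∈ Finset.range J, c j - ∑ j ∈ Finset.range J, A j)
          (∑ j ∈ Finset.range J, A j)
    _ ≤ 2 * H + J * (ε / 2) := add_le_add hdiff hCS
    _ < J * ε := by linarith

theorem rotateSquare_rotateSquare (d e x : ℝ × ℝ) :
    rotateSquare d (rotateSquare e x) = rotateSquare (e + d) x := by
  have h : ∀ a b c : ℝ, Int.fract (Int.fract (a + b) + c) = Int.fract (a + (b + c)) := by
    intro a b c
    rw [Int.fract_eq_fract]
    exact ⟨-⌊a + b⌋, by rw [← Int.self_sub_floor]; push_cast; ring⟩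
  simp only [rotateSquare, h]
  rfl

/-- For n = 0 it fails outside the unit square: the identity does not reduce modulo 1. -/
theorem iterate_rotateSquare (d x : ℝ × ℝ) {n : ℕ} (hn : n ≠ 0) :
    (rotateSquare d)^[n] x = rotateSquare ((n : ℝ) • d) x := by
  obtain ⟨n, rfl⟩ := Nat.exists_eq_succ_of_ne_zero hn
  clear hn
  induction n with
  | zero => simp
  | succ n ih =>
    rw [Function.iterate_succ_apply', ih, rotateSquare_rotateSquare]
    congr 1
    push_cast
    module

namespace PolysquareSurface

variable {σ : Type*} (P : PolysquareSurface σ)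

/-- Iterates remain skew products. Bare existence of the fibre permutations is enough, since
`ae_eq_zero_of_skew_eigen` asks for no measurability of them. -/
theorem exists_iterate_stepMap_eq (d : ℝ × ℝ) (n : ℕ) :
    ∃ π : ℝ × ℝ → Equiv.Perm σ, ∀ p, (P.stepMap d)^[n] p =
      ((rotateSquare d)^[n] p.1, π p.1 p.2) := by
  induction n with
  | zero => exact ⟨fun _ => 1, fun p => rfl⟩
  | succ n ih =>
    obtain ⟨π, hπ⟩ := ih
    classical
    refine ⟨fun x => P.crossPerm (crossTime d.1 ((rotateSquare d)^[n] x).1 <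
      crossTime d.2 ((rotateSquare d)^[n] x).2) ⌊((rotateSquare d)^[n] x).1 + d.1⌋
      ⌊((rotateSquare d)^[n] x).2 + d.2⌋ * π x, fun p => ?_⟩
    rw [Function.iterate_succ_apply', Function.iterate_succ_apply', hπ]
    simp only [stepMap, Equiv.Perm.mul_apply]

theorem tendsto_integral_norm_sq_stepMap_average [Fintype σ] [MeasurableSpace σ]
    [DiscreteMeasurableSpace σ] {v : ℝ × ℝ} {N : ℕ} (hN : N ≠ 0) (c : ℂ) (hc : ‖c‖ = 1)
    (hcv : ∀ r : ℕ, 1 ≤ r → ∀ n, planeChar n v ≠ c ^ r)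
    {F : (ℝ × ℝ) × σ → ℂ} (hF : F ∈ convexStepFunctions σ) (hb : ∀ p, ‖F p‖ ≤ 1) :
    Tendsto (fun H : ℕ => ∫ p, ‖(H : ℂ)⁻¹ * ∑ h ∈ Finset.range H,
      c ^ h * F (((P.stepMap ((N : ℝ)⁻¹ • v))^[N])^[h] p)‖ ^ 2
        ∂(unitSquareMeasure.prod Measure.count)) atTop (𝓝 0) := by
  refine tendsto_integral_norm_sq_twisted_average _ _
    ((P.measurePreserving_stepMap _).iterate N) c hc ?_ F
    (measurable_of_mem_convexStepFunctions hF) hb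
  intro g hg h01 he
  obtain ⟨π, hπ⟩ := P.exists_iterate_stepMap_eq ((N : ℝ)⁻¹ • v) N
  refine ae_eq_zero_of_skew_eigen unitSquareMeasure (rotateSquare v) π c hc ?_ g hg h01 ?_
  · intro r hr h hh hhb hhe
    exact ae_eq_zero_of_rotateSquare_eigen v (c ^ r) (hcv r hr) h hh hhb hhe
  · filter_upwards [he] with p hp
    rw [hπ, iterate_rotateSquare _ _ hN, smul_inv_smul₀ (by exact_mod_cast hN)] at hp
    exact hp

/-- Along an equidistributed orbit, the averages of a step function twisted by a phase that does
not resonate with the rotation tend to zero. -/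
theorem tendsto_twisted_average_zero [Fintype σ] [MeasurableSpace σ]
    [DiscreteMeasurableSpace σ] {v : ℝ × ℝ} {N : ℕ} (hN : N ≠ 0)
    (hs1 : |(N : ℝ)⁻¹ * v.1| < 1) (hs2 : |(N : ℝ)⁻¹ * v.2| < 1) (c : ℂ) (hc : ‖c‖ = 1)
    (hcv : ∀ r : ℕ, 1 ≤ r → ∀ n, planeChar n v ≠ c ^ r)
    (b : ℕ → (ℝ × ℝ) × σ) (hbQ : ∀ j, (b j).1 ∈ Set.Ico (0 : ℝ) 1 ×ˢ Set.Ico (0 : ℝ) 1)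
    (hbT : ∀ j, b (j + 1) = (P.stepMap ((N : ℝ)⁻¹ • v))^[N] (b j))
    (hb : ∀ (C : Set (ℝ × ℝ)) (i : σ), Convex ℝ C → MeasurableSet C →
      C ⊆ Set.Ico 0 1 ×ˢ Set.Ico 0 1 →
      Tendsto (fun J : ℕ => (J : ℂ)⁻¹ *
        ∑ j ∈ Finset.range J, (C ×ˢ {i}).indicator (1 : (ℝ × ℝ) × σ → ℂ) (b j)) atTop
        (𝓝 ((volume.real C / Fintype.card σ : ℝ) : ℂ)))
    {F : (ℝ × ℝ) × σ → ℂ} (hF : F ∈ convexStepFunctions σ) (hFb : ∀ p, ‖F p‖ ≤ 1) :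
    Tendsto (fun J : ℕ => (J : ℂ)⁻¹ * ∑ j ∈ Finset.range J, c ^ j * F (b j)) atTop (𝓝 0) := by
  let T := (P.stepMap ((N : ℝ)⁻¹ • v))^[N]
  have hbTk : ∀ j k, b (j + k) = T^[k] (b j) := by
    intro j k
    induction k with
    | zero => rfl
    | succ k ih => rw [← add_assoc, hbT, ih, Function.iterate_succ_apply']
  refine tendsto_average_zero_of_short_averages (fun j => c ^ j * F (b j))
    (fun j => by rw [norm_mul, norm_pow, hc, one_pow, one_mul]; exact hFb _) fun ε hε => ?_
  have hlim := (P.tendsto_integral_norm_sq_stepMap_average hN c hc hcv hF hFb).const_mul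
    ((Fintype.card σ : ℝ)⁻¹)
  rw [mul_zero] at hlim
  obtain ⟨H, hHε, hH⟩ := ((hlim.eventually (gt_mem_nhds hε)).and (eventually_ne_atTop 0)).exists
  refine ⟨H, hH, ?_⟩
  let Q : Set ((ℝ × ℝ) × σ) := (Set.Ico 0 1 ×ˢ Set.Ico 0 1) ×ˢ Set.univ
  -- The short average as a function on the surface. As |c| = 1, the average of the sequence over
  -- the indices j, …, j + H − 1 has the modulus of `G (b j)`.
  let G : (ℝ × ℝ) × σ → ℂ := (H : ℂ)⁻¹ • ∑ h ∈ Finset.range H, c ^ h •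
    Q.indicator (F ∘ (P.stepMap ((N : ℝ)⁻¹ • v))^[N * h])
  have hG : G ∈ convexStepFunctions σ := Submodule.smul_mem _ _ (Submodule.sum_mem _ fun h _ =>
    Submodule.smul_mem _ _ (P.comp_iterate_mem_convexStepFunctions (by simpa using hs1)
      (by simpa using hs2) hF _))
  have hGQ : ∀ p ∈ Q, G p = (H : ℂ)⁻¹ * ∑ h ∈ Finset.range H, c ^ h * F (T^[h] p) := by
    intro p hp
    simp only [G, Pi.smul_apply, Finset.sum_apply, smul_eq_mul, Set.indicator_of_mem hp,
      Function.comp_apply, T, ← Function.iterate_mul]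
  have hconv := tendsto_average_of_mem_convexStepFunctions b hb
    (norm_sq_mem_convexStepFunctions hG)
  have hint : ∫ p, ((‖G p‖ ^ 2 : ℝ) : ℂ) ∂(unitSquareMeasure.prod (Measure.count (α := σ))) =
      ((∫ p, ‖(H : ℂ)⁻¹ * ∑ h ∈ Finset.range H, c ^ h * F (T^[h] p)‖ ^ 2
        ∂(unitSquareMeasure.prod Measure.count) : ℝ) : ℂ) := by
    rw [← integral_complex_ofReal]
    apply integral_congr_ae
    have hae : ∀ᵐ p ∂(unitSquareMeasure.prod (Measure.count (α := σ))), p ∈ Q := by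
      filter_upwards [Measure.quasiMeasurePreserving_fst.ae ae_mem_unitSquare] with p hp
      exact ⟨hp, Set.mem_univ _⟩
    filter_upwards [hae] with p hp
    rw [hGQ p hp]
  rw [hint] at hconv
  have hre := (Complex.continuous_re.tendsto _).comp hconv
  have e1 : ((Fintype.card σ : ℂ)⁻¹ * ((∫ p, ‖(H : ℂ)⁻¹ * ∑ h ∈ Finset.range H,
      c ^ h * F (T^[h] p)‖ ^ 2 ∂(unitSquareMeasure.prod Measure.count) : ℝ) : ℂ)).re < ε := by
    rw [← Complex.ofReal_natCast, ← Complex.ofReal_inv, Complex.re_ofReal_mul, Complex.ofReal_re]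
    exact hHε
  filter_upwards [hre.eventually (gt_mem_nhds e1)] with J hJ
  refine lt_of_eq_of_lt ?_ hJ
  rw [Function.comp_apply, ← Complex.ofReal_natCast J, ← Complex.ofReal_inv, ← Complex.ofReal_sum,
    Complex.re_ofReal_mul, Complex.ofReal_re]
  congr 1
  refine Finset.sum_congr rfl fun j _ => ?_
  rw [hGQ _ ⟨hbQ j, Set.mem_univ _⟩]
  have e2 : (H : ℂ)⁻¹ * ∑ k ∈ Finset.range H, c ^ (j + k) * F (b (j + k)) =
      c ^ j * ((H : ℂ)⁻¹ * ∑ h ∈ Finset.range H, c ^ h * F (T^[h] (b j))) := by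
    have e3 : ∀ k, c ^ (j + k) * F (b (j + k)) = c ^ j * (c ^ k * F (T^[k] (b j))) := fun k => by
      rw [hbTk, pow_add, mul_assoc]
    simp only [e3]
    rw [← Finset.mul_sum, mul_left_comm]
  rw [e2, norm_mul, norm_pow, hc, one_pow, one_mul]

end PolysquareSurface

/-! ### Equidistribution from exponential sums -/

/-- Serves to discard the part of the sequence that may precede a vertex. -/
theorem tendsto_average_shift_iff (f : ℕ → ℂ) (hf : ∀ j, ‖f j‖ ≤ 1) (n : ℕ) (l : ℂ) :
    Tendsto (fun J : ℕ => (J : ℂ)⁻¹ * ∑ j ∈ Finset.range J, f (j + n)) atTop (𝓝 l) ↔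
      Tendsto (fun J : ℕ => (J : ℂ)⁻¹ * ∑ j ∈ Finset.range J, f j) atTop (𝓝 l) := by
  have hsum : ∀ a n : ℕ, ‖∑ j ∈ Finset.range n, f (a + j)‖ ≤ n := fun a n => by
    simpa using norm_sum_le_of_le (Finset.range n) (fun j _ => hf (a + j))
  refine tendsto_iff_of_dist ?_
  refine squeeze_zero (fun _ => dist_nonneg) (fun J => ?_)
    (tendsto_const_div_atTop_nhds_zero_nat (2 * (n : ℝ)))
  have e1 := Finset.sum_range_add f n J
  have e2 := Finset.sum_range_add f J n
  rw [add_comm n J, e2] at e1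
  have e3 : ∑ j ∈ Finset.range J, f (j + n) - ∑ j ∈ Finset.range J, f j =
      ∑ j ∈ Finset.range n, f (J + j) - ∑ j ∈ Finset.range n, f (0 + j) := by
    simp only [add_comm _ n, zero_add]
    linear_combination -e1
  rw [dist_eq_norm, ← mul_sub, e3, norm_mul, norm_inv, Complex.norm_natCast, div_eq_inv_mul]
  refine mul_le_mul_of_nonneg_left ?_ (by positivity)
  linarith [norm_sub_le (∑ j ∈ Finset.range n, f (J + j)) (∑ j ∈ Finset.range n, f (0 + j)),
    hsum 0 n, hsum J n]

theorem integral_fourier_unitAddCircle (k : ℤ) :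
    ∫ x : UnitAddCircle, fourier k x = if k = 0 then 1 else 0 := by
  split_ifs with hk
  · subst hk
    simp [measureReal_def]
  · exact integral_eq_zero_of_add_right_eq_neg (g := ((1 / 2 / k : ℝ) : UnitAddCircle))
      (fun x => fourier_add_half_inv_index hk one_pos x)

/-- Weyl's criterion with weights. -/
theorem tendsto_weighted_average_of_fourier (x : ℕ → UnitAddCircle) (g : ℕ → ℂ)
    (hg : ∀ j, ‖g j‖ ≤ 1) (m : ℂ) (hm : ‖m‖ ≤ 1)
    (h : ∀ k : ℤ, Tendsto (fun J : ℕ => (J : ℂ)⁻¹ * ∑ j ∈ Finset.range J, g j * fourier k (x j))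
      atTop (𝓝 (if k = 0 then m else 0))) (φ : C(UnitAddCircle, ℂ)) :
    Tendsto (fun J : ℕ => (J : ℂ)⁻¹ * ∑ j ∈ Finset.range J, g j * φ (x j)) atTop
      (𝓝 (m * ∫ t, φ t)) := by
  have hint : ∀ φ : C(UnitAddCircle, ℂ), Integrable (fun t => φ t) (volume) := fun φ =>
    .of_bound φ.continuous.aestronglyMeasurable ‖φ‖ (.of_forall fun t => φ.norm_coe_le_norm t)
  have hspan : ∀ ψ ∈ Submodule.span ℂ (Set.range (fourier (T := 1))),
      Tendsto (fun J : ℕ => (J : ℂ)⁻¹ * ∑ j ∈ Finset.range J, g j * ψ (x j)) atTop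
        (𝓝 (m * ∫ t, ψ t)) := by
    intro ψ hψ
    induction hψ using Submodule.span_induction with
    | mem ψ h' =>
      obtain ⟨k, rfl⟩ := h'
      rw [integral_fourier_unitAddCircle]
      simpa using h k
    | zero => simp
    | add ψ χ _ _ hψ hχ =>
      convert hψ.add hχ using 2
      · simp only [ContinuousMap.add_apply, mul_add, Finset.sum_add_distrib]
      · rw [← mul_add, ← integral_add (hint ψ) (hint χ)]; rfl
    | smul c ψ _ hψ =>
      convert hψ.const_mul c using 2
      · simp only [ContinuousMap.smul_apply, smul_eq_mul, mul_left_comm _ c, ← Finset.mul_sum]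
      · simp only [ContinuousMap.smul_apply, smul_eq_mul, integral_const_mul]; ring
  rw [Metric.tendsto_atTop]
  intro ε hε
  have hφ : φ ∈ (Submodule.span ℂ (Set.range (fourier (T := 1)))).topologicalClosure := by
    rw [span_fourier_closure_eq_top]; trivial
  obtain ⟨ψ, hψ, hd⟩ := Metric.mem_closure_iff.1 hφ (ε / 3) (by positivity)
  rw [dist_eq_norm] at hd
  obtain ⟨J₀, hJ₀⟩ := Metric.tendsto_atTop.1 (hspan ψ hψ) (ε / 3) (by positivity)
  refine ⟨J₀, fun J hJ => ?_⟩
  have h1 := hJ₀ J hJ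
  have h2 : dist ((J : ℂ)⁻¹ * ∑ j ∈ Finset.range J, g j * φ (x j))
      ((J : ℂ)⁻¹ * ∑ j ∈ Finset.range J, g j * ψ (x j)) ≤ ‖φ - ψ‖ := by
    rw [dist_eq_norm, ← mul_sub, ← Finset.sum_sub_distrib, norm_mul, norm_inv,
      Complex.norm_natCast]
    have h3 : ‖∑ j ∈ Finset.range J, (g j * φ (x j) - g j * ψ (x j))‖ ≤ J * ‖φ - ψ‖ := by
      have := norm_sum_le_of_le (Finset.range J)
        (f := fun j => g j * φ (x j) - g j * ψ (x j)) (n := fun _ => ‖φ - ψ‖) fun j _ => by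
          rw [← mul_sub, norm_mul]
          exact (mul_le_mul (hg j) ((φ - ψ).norm_coe_le_norm (x j)) (norm_nonneg _)
            zero_le_one).trans (one_mul _).le
      simpa using this
    rcases J.eq_zero_or_pos with rfl | hJ
    · simp
    · rwa [inv_mul_le_iff₀ (by exact_mod_cast hJ)]
  have h4 : dist (m * ∫ t, ψ t) (m * ∫ t, φ t) ≤ ‖φ - ψ‖ := by
    rw [dist_comm, dist_eq_norm, ← mul_sub, ← integral_sub (hint φ) (hint ψ), norm_mul]
    have h5 := norm_integral_le_of_norm_le_const (μ := (volume : Measure UnitAddCircle))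
      (f := fun t => φ t - ψ t) (.of_forall fun t => (φ - ψ).norm_coe_le_norm t)
    have h6 : (volume : Measure UnitAddCircle).real Set.univ = 1 := by simp [measureReal_def]
    rw [h6, mul_one] at h5
    exact (mul_le_mul hm h5 (norm_nonneg _) zero_le_one).trans (one_mul _).le
  refine (dist_triangle4 _ _ _ _).trans_lt ((add_lt_add_of_lt_of_le (add_lt_add_of_le_of_lt h2 h1)
    h4).trans ?_)
  linarith

/-- The indicator of a closed set is a decreasing limit of continuous functions. This upper bound is
enough: applied to an interval and to its complement it gives both inequalities. -/
theorem eventually_weighted_average_closed_lt (x : ℕ → UnitAddCircle) (g : ℕ → ℝ)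
    (hg0 : ∀ j, 0 ≤ g j) (hg1 : ∀ j, g j ≤ 1) (m : ℝ) (hm0 : 0 ≤ m) (hm1 : m ≤ 1)
    (h : ∀ k : ℤ, Tendsto (fun J : ℕ => (J : ℂ)⁻¹ * ∑ j ∈ Finset.range J, g j * fourier k (x j))
      atTop (𝓝 (if k = 0 then (m : ℂ) else 0))) {K : Set UnitAddCircle} (hK : IsClosed K)
    {ε : ℝ} (hε : 0 < ε) :
    ∀ᶠ J : ℕ in atTop, (J : ℝ)⁻¹ * ∑ j ∈ Finset.range J, g j * K.indicator 1 (x j) <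
      m * volume.real K + ε := by
  have hlim := HasOuterApproxClosed.tendsto_lintegral_apprSeq hK (volume : Measure UnitAddCircle)
  have hlim2 : Tendsto (fun n => ∫ t, ((hK.apprSeq n t : ℝ≥0) : ℝ)) atTop
      (𝓝 (volume.real K)) := by
    have := (ENNReal.tendsto_toReal (measure_ne_top volume K)).comp hlim
    refine this.congr fun n => ?_
    rw [integral_eq_lintegral_of_nonneg_ae (.of_forall fun _ => NNReal.coe_nonneg _)]
    · simp
    · exact (NNReal.continuous_coe.comp (hK.apprSeq n).continuous).aestronglyMeasurable
  obtain ⟨n, hn⟩ := (hlim2.eventually (gt_mem_nhds (lt_add_of_pos_right _ (half_pos hε)))).exists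
  let φ : C(UnitAddCircle, ℂ) := ⟨fun t => (((hK.apprSeq n t : ℝ≥0) : ℝ) : ℂ),
    Complex.continuous_ofReal.comp (NNReal.continuous_coe.comp (hK.apprSeq n).continuous)⟩
  have hconv := tendsto_weighted_average_of_fourier x (fun j => (g j : ℂ))
    (fun j => by rw [Complex.norm_real, Real.norm_eq_abs, abs_of_nonneg (hg0 j)]; exact hg1 j) m
    (by rw [Complex.norm_real, Real.norm_eq_abs, abs_of_nonneg hm0]; exact hm1) h φ
  have hre := (Complex.continuous_re.tendsto _).comp hconv
  have e1 : ((m : ℂ) * ∫ t, φ t).re < m * volume.real K + ε := by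
    have : ∫ t, φ t = ((∫ t, ((hK.apprSeq n t : ℝ≥0) : ℝ) : ℝ) : ℂ) := integral_complex_ofReal
    rw [this, Complex.re_ofReal_mul, Complex.ofReal_re]
    nlinarith [mul_le_mul_of_nonneg_left hn.le hm0]
  filter_upwards [hre.eventually (gt_mem_nhds e1)] with J hJ
  refine lt_of_le_of_lt ?_ hJ
  have e2 : (Complex.re ∘ fun J : ℕ => (J : ℂ)⁻¹ * ∑ j ∈ Finset.range J, (g j : ℂ) * φ (x j)) J =
      (J : ℝ)⁻¹ * ∑ j ∈ Finset.range J, g j * ((hK.apprSeq n (x j) : ℝ≥0) : ℝ) := by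
    rw [Function.comp_apply, ← Complex.ofReal_natCast J, ← Complex.ofReal_inv,
      Complex.re_ofReal_mul, Complex.re_sum]
    simp [φ]
  rw [e2]
  refine mul_le_mul_of_nonneg_left (Finset.sum_le_sum fun j _ =>
    mul_le_mul_of_nonneg_left ?_ (hg0 j)) (by positivity)
  by_cases hj : x j ∈ K
  · rw [Set.indicator_of_mem hj, Pi.one_apply]
    rw [HasOuterApproxClosed.apprSeq_apply_eq_one hK n hj]
    simp
  · rw [Set.indicator_of_notMem hj]
    exact NNReal.coe_nonneg _

/-- The projection of [0,1] to the circle identifies only 0 and 1, so saturating S adds at most the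
null set {1} inside (0,1]. -/
theorem volume_real_coe_image_le {S : Set ℝ} (hS : S ⊆ Set.Icc 0 1) (hc : IsCompact S) :
    volume.real ((↑) '' S : Set UnitAddCircle) ≤ volume.real S := by
  have hmp := UnitAddCircle.measurePreserving_mk 0
  have hm : MeasurableSet ((↑) '' S : Set UnitAddCircle) :=
    (hc.image (AddCircle.continuous_mk' 1)).isClosed.measurableSet
  have hle : volume ((↑) '' S : Set UnitAddCircle) ≤ volume S := by
    rw [← hmp.measure_preimage hm.nullMeasurableSet, Measure.restrict_apply (hmp.measurable hm)]
    have hsub : ((↑) ⁻¹' ((↑) '' S : Set UnitAddCircle) ∩ Set.Ioc (0 : ℝ) (0 + 1)) ⊆ S ∪ {1} := by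
      rintro z ⟨⟨y, hy, hyz⟩, hz0, hz1⟩
      obtain ⟨hy0, hy1⟩ := hS hy
      have hyz' : ((y : ℝ) : UnitAddCircle) = (z : UnitAddCircle) := hyz
      rw [← sub_eq_zero, ← AddCircle.coe_sub, AddCircle.coe_eq_zero_iff] at hyz'
      obtain ⟨n, hn⟩ := hyz'
      simp only [zsmul_eq_mul, mul_one] at hn
      have h1 : (-2 : ℤ) < n := by
        have : (-2 : ℝ) < n := by linarith
        exact_mod_cast this
      have h2 : n < (1 : ℤ) := by
        have : (n : ℝ) < 1 := by linarith
        exact_mod_cast this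
      have h3 : n = -1 ∨ n = 0 := by omega
      rcases h3 with rfl | rfl
      · right
        push_cast at hn
        rw [Set.mem_singleton_iff]
        linarith
      · left
        push_cast at hn
        have : z = y := by linarith
        rwa [this]
    refine (measure_mono hsub).trans ((measure_union_le _ _).trans ?_)
    simp
  exact ENNReal.toReal_mono hc.measure_lt_top.ne hle

/-- Weyl's criterion with weights, for intervals. -/
theorem tendsto_weighted_average_Ico (z : ℕ → ℝ) (hz : ∀ j, z j ∈ Set.Ico (0 : ℝ) 1) (g : ℕ → ℝ)
    (hg0 : ∀ j, 0 ≤ g j) (hg1 : ∀ j, g j ≤ 1) (m : ℝ) (hm0 : 0 ≤ m) (hm1 : m ≤ 1)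
    (h : ∀ k : ℤ, Tendsto (fun J : ℕ => (J : ℂ)⁻¹ *
      ∑ j ∈ Finset.range J, g j * fourier k ((z j : ℝ) : UnitAddCircle))
      atTop (𝓝 (if k = 0 then (m : ℂ) else 0)))
    {α β : ℝ} (hα : 0 ≤ α) (hαβ : α ≤ β) (hβ : β ≤ 1) :
    Tendsto (fun J : ℕ => (J : ℝ)⁻¹ * ∑ j ∈ Finset.range J, g j * (Set.Ico α β).indicator 1 (z j))
      atTop (𝓝 (m * (β - α))) := by
  have hS₁ : Set.Icc α β ⊆ Set.Icc 0 1 := Set.Icc_subset_Icc hα hβ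
  -- A closed cover of the complement of [α,β) in [0,1), of length exactly 1 − (β − α).
  have hS₂ : Set.Icc 0 α ∪ Set.Icc β 1 ⊆ Set.Icc 0 1 := Set.union_subset
    (Set.Icc_subset_Icc_right (hαβ.trans hβ)) (Set.Icc_subset_Icc_left (hα.trans hαβ))
  have hc₂ : IsCompact (Set.Icc 0 α ∪ Set.Icc β 1) := isCompact_Icc.union isCompact_Icc
  have hv₁ : volume.real ((↑) '' Set.Icc α β : Set UnitAddCircle) ≤ β - α :=
    (volume_real_coe_image_le hS₁ isCompact_Icc).trans
      (by rw [Real.volume_real_Icc_of_le hαβ])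
  have hv₂ : volume.real ((↑) '' (Set.Icc 0 α ∪ Set.Icc β 1) : Set UnitAddCircle) ≤
      1 - (β - α) := by
    refine (volume_real_coe_image_le hS₂ hc₂).trans ((measureReal_union_le _ _).trans ?_)
    rw [Real.volume_real_Icc_of_le hα, Real.volume_real_Icc_of_le hβ]
    linarith
  have hG : Tendsto (fun J : ℕ => (J : ℝ)⁻¹ * ∑ j ∈ Finset.range J, g j) atTop (𝓝 m) := by
    have h0 := (Complex.continuous_re.tendsto _).comp (h 0)
    simp only [if_true, Complex.ofReal_re] at h0
    refine h0.congr fun J => ?_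
    rw [Function.comp_apply, ← Complex.ofReal_natCast J, ← Complex.ofReal_inv,
      Complex.re_ofReal_mul, Complex.re_sum]
    simp
  have hup : ∀ {S : Set ℝ}, S ⊆ Set.Icc 0 1 → IsCompact S → ∀ {E : Set ℝ} {c : ℝ},
      Set.Ico 0 1 ∩ E ⊆ S → volume.real ((↑) '' S : Set UnitAddCircle) ≤ c → ∀ ε > 0,
      ∀ᶠ J : ℕ in atTop, (J : ℝ)⁻¹ * ∑ j ∈ Finset.range J, g j * E.indicator 1 (z j) <
        m * c + ε := by
    intro S hS hc E c hES hv ε hε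
    have hcl : IsClosed ((↑) '' S : Set UnitAddCircle) :=
      (hc.image (AddCircle.continuous_mk' 1)).isClosed
    filter_upwards [eventually_weighted_average_closed_lt (fun j => ((z j : ℝ) : UnitAddCircle)) g
      hg0 hg1 m hm0 hm1 h hcl hε] with J hJ
    refine lt_of_le_of_lt (mul_le_mul_of_nonneg_left (Finset.sum_le_sum fun j _ =>
      mul_le_mul_of_nonneg_left ?_ (hg0 j)) (by positivity))
      (hJ.trans_le (add_le_add_left (mul_le_mul_of_nonneg_left hv hm0) _))
    by_cases hj : z j ∈ E
    · have hj' : ((z j : ℝ) : UnitAddCircle) ∈ ((↑) '' S : Set UnitAddCircle) :=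
        ⟨z j, hES ⟨hz j, hj⟩, rfl⟩
      rw [Set.indicator_of_mem hj, Set.indicator_of_mem hj']
      rfl
    · rw [Set.indicator_of_notMem hj]
      exact Set.indicator_nonneg (fun _ _ => zero_le_one) _
  have hsplit : ∀ J : ℕ, (J : ℝ)⁻¹ * ∑ j ∈ Finset.range J, g j * (Set.Ico α β).indicator 1 (z j) =
      (J : ℝ)⁻¹ * ∑ j ∈ Finset.range J, g j -
        (J : ℝ)⁻¹ * ∑ j ∈ Finset.range J, g j * ((Set.Ico α β)ᶜ).indicator 1 (z j) := by
    intro J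
    rw [← mul_sub, ← Finset.sum_sub_distrib]
    congr 1
    refine Finset.sum_congr rfl fun j _ => ?_
    by_cases hj : z j ∈ Set.Ico α β
    · rw [Set.indicator_of_mem hj, Set.indicator_of_notMem (Set.notMem_compl_iff.2 hj)]
      simp
    · rw [Set.indicator_of_notMem hj, Set.indicator_of_mem hj]
      simp
  rw [tendsto_order]
  constructor
  · intro a ha
    let δ := (m * (β - α) - a) / 2
    have hδ : 0 < δ := by simp only [δ]; linarith
    have hGl := hG.eventually (lt_mem_nhds (show m - δ < m by linarith))
    have hu := hup hS₂ hc₂ (E := (Set.Ico α β)ᶜ) (by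
      rintro y ⟨⟨hy0, hy1⟩, hy⟩
      rw [Set.mem_compl_iff, Set.mem_Ico, not_and_or, not_le, not_lt] at hy
      rcases hy with hy | hy
      · exact Or.inl ⟨hy0, hy.le⟩
      · exact Or.inr ⟨hy, hy1.le⟩) hv₂ δ hδ
    filter_upwards [hGl, hu] with J h1 h2
    rw [hsplit]
    simp only [δ] at h1 h2
    nlinarith
  · intro a ha
    filter_upwards [hup hS₁ isCompact_Icc (E := Set.Ico α β)
      (fun y hy => ⟨hy.2.1, hy.2.2.le⟩) hv₁ (a - m * (β - α)) (by linarith)] with J hJ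
    linarith

/-! ### From boxes to convex sets -/

/-- The half-open unit cube. -/
def unitCube : Set ((ℝ × ℝ) × ℝ) := (Set.Ico 0 1 ×ˢ Set.Ico 0 1) ×ˢ Set.Ico 0 1

theorem measurableSet_unitCube : MeasurableSet unitCube :=
  (measurableSet_Ico.prod measurableSet_Ico).prod measurableSet_Ico

theorem volume_unitCube : volume unitCube = 1 := by
  simp [unitCube, Measure.volume_eq_prod, Measure.prod_prod]

/-- The uniform probability measure on the first `J + 1` points of a sequence. -/
noncomputable def empiricalMeasure {Ω : Type*} [MeasurableSpace Ω] (q : ℕ → Ω) (J : ℕ) :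
    ProbabilityMeasure Ω :=
  ⟨((J + 1 : ℕ) : ENNReal)⁻¹ • ∑ j ∈ Finset.range (J + 1), Measure.dirac (q j), ⟨by
    rw [Measure.smul_apply, Measure.finsetSum_apply]
    simp only [measure_univ, Finset.sum_const, Finset.card_range, nsmul_eq_mul, mul_one,
      smul_eq_mul]
    exact ENNReal.inv_mul_cancel (by simp) (by simp)⟩⟩

theorem coe_empiricalMeasure_apply {Ω : Type*} [MeasurableSpace Ω] [MeasurableSingletonClass Ω]
    (q : ℕ → Ω) (J : ℕ) (E : Set Ω) : (empiricalMeasure q J E : ℝ) =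
      ((J + 1 : ℕ) : ℝ)⁻¹ * ∑ j ∈ Finset.range (J + 1), E.indicator 1 (q j) := by
  change ((((J + 1 : ℕ) : ENNReal)⁻¹ • ∑ j ∈ Finset.range (J + 1), Measure.dirac (q j)) E).toReal = _
  rw [Measure.smul_apply, Measure.finsetSum_apply, smul_eq_mul, ENNReal.toReal_mul,
    ENNReal.toReal_inv, ENNReal.toReal_natCast, ENNReal.toReal_sum (fun j _ => measure_ne_top _ _)]
  congr 1
  refine Finset.sum_congr rfl fun j _ => ?_
  rw [Measure.dirac_apply]
  by_cases hj : q j ∈ E <;> simp [hj]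

/-- Equidistribution in boxes implies equidistribution in convex sets. -/
theorem tendsto_average_indicator_convex {σ : Type*} [Fintype σ] [Nonempty σ]
    (q : ℕ → ((ℝ × ℝ) × ℝ) × σ) (hq : ∀ j, (q j).1 ∈ unitCube)
    (h : ∀ (C : Set (ℝ × ℝ)) (i : σ) (α β : ℝ), Convex ℝ C → MeasurableSet C →
      C ⊆ Set.Ico 0 1 ×ˢ Set.Ico 0 1 → 0 ≤ α → α ≤ β → β ≤ 1 →
      Tendsto (fun J : ℕ => (J : ℝ)⁻¹ * ∑ j ∈ Finset.range J,
        ((C ×ˢ Set.Ico α β) ×ˢ {i}).indicator 1 (q j)) atTop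
        (𝓝 (volume.real C / Fintype.card σ * (β - α))))
    {S : Set ((ℝ × ℝ) × ℝ)} (hS : Convex ℝ S) (hSQ : S ⊆ unitCube) (i : σ) :
    Tendsto (fun J : ℕ => (J : ℝ)⁻¹ * ∑ j ∈ Finset.range J, (S ×ˢ {i}).indicator 1 (q j)) atTop
      (𝓝 (volume.real S / Fintype.card σ)) := by
  let : MeasurableSpace σ := ⊤
  have : DiscreteMeasurableSpace σ := ⟨fun _ => trivial⟩
  let : TopologicalSpace σ := ⊥
  have : DiscreteTopology σ := ⟨rfl⟩
  have hcard : (Fintype.card σ : ENNReal) ≠ 0 := by simp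
  let cnt : Measure σ := (Fintype.card σ : ENNReal)⁻¹ • Measure.count
  have hcnt : IsProbabilityMeasure cnt := ⟨by
    simp only [cnt, Measure.smul_apply, smul_eq_mul]
    rw [Measure.count_apply MeasurableSet.univ, Set.encard_univ, ENat.card_eq_coe_fintype_card]
    exact ENNReal.inv_mul_cancel (by simp) (by simp)⟩
  have hcube : IsProbabilityMeasure ((volume : Measure ((ℝ × ℝ) × ℝ)).restrict unitCube) :=
    ⟨by rw [Measure.restrict_apply_univ, volume_unitCube]⟩
  let ν : ProbabilityMeasure (((ℝ × ℝ) × ℝ) × σ) :=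
    ⟨((volume : Measure ((ℝ × ℝ) × ℝ)).restrict unitCube).prod cnt, inferInstance⟩
  have hν : ∀ (A : Set ((ℝ × ℝ) × ℝ)) (k : σ),
      (ν (A ×ˢ {k}) : ℝ) = volume.real (A ∩ unitCube) / Fintype.card σ := by
    intro A k
    change ((((volume : Measure ((ℝ × ℝ) × ℝ)).restrict unitCube).prod cnt) (A ×ˢ {k})).toReal = _
    rw [Measure.prod_prod, Measure.restrict_apply' measurableSet_unitCube, ENNReal.toReal_mul]
    simp [cnt, measureReal_def, div_eq_mul_inv]
  -- The sets are not confined to the cube, so that every point has arbitrarily small neighbourhoods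
  -- among them. Convergence of measures on such a π-system implies weak convergence.
  let 𝒮 : Set (Set (((ℝ × ℝ) × ℝ) × σ)) := {s | ∃ (C : Set (ℝ × ℝ)) (a b : ℝ) (k : σ),
    Convex ℝ C ∧ MeasurableSet C ∧ s = (C ×ˢ Set.Ico a b) ×ˢ {k}}
  have hπ : IsPiSystem 𝒮 := by
    rintro _ ⟨C, a, b, k, hC, hCm, rfl⟩ _ ⟨D, a', b', k', hD, hDm, rfl⟩ hne
    have hk : k = k' := by
      obtain ⟨x, hx, hx'⟩ := hne
      exact (Set.mem_singleton_iff.1 hx.2).symm.trans (Set.mem_singleton_iff.1 hx'.2)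
    subst hk
    refine ⟨C ∩ D, a ⊔ a', b ⊓ b', k, hC.inter hD, hCm.inter hDm, ?_⟩
    rw [Set.prod_inter_prod, Set.prod_inter_prod, Set.Ico_inter_Ico, Set.inter_self]
  have hlim : Tendsto (empiricalMeasure q) atTop (𝓝 ν) := by
    refine hπ.tendsto_probabilityMeasure_of_tendsto_of_mem ?_ ?_ ?_
    · rintro _ ⟨C, a, b, k, -, hCm, rfl⟩
      exact (hCm.prod measurableSet_Ico).prod MeasurableSet.of_discrete
    · rintro u hu ⟨⟨x, z⟩, k⟩ hx
      have hu' := hu.mem_nhds hx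
      obtain ⟨U, hU, V, hV, hUV⟩ := mem_nhds_prod_iff.1 hu'
      obtain ⟨A, hA, B, hB, hAB⟩ := mem_nhds_prod_iff.1 hU
      obtain ⟨r, hr, hrA⟩ := Metric.mem_nhds_iff.1 hA
      obtain ⟨a, b, ⟨haz, hzb⟩, hab⟩ := mem_nhds_iff_exists_Ioo_subset.1 hB
      refine ⟨(Metric.ball x r ×ˢ Set.Ico ((a + z) / 2) b) ×ˢ {k},
        ⟨_, _, _, _, convex_ball x r, measurableSet_ball, rfl⟩, ?_, ?_⟩
      · exact prod_mem_nhds (prod_mem_nhds (Metric.ball_mem_nhds x hr)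
          (Ico_mem_nhds (by linarith) hzb)) (mem_nhds_discrete.2 rfl)
      · refine (Set.prod_mono ((Set.prod_mono hrA ?_).trans hAB) ?_).trans hUV
        · exact fun y hy => hab ⟨by linarith [hy.1], hy.2⟩
        · exact Set.singleton_subset_iff.2 (mem_of_mem_nhds hV)
    · rintro _ ⟨C, a, b, k, hC, hCm, rfl⟩
      rw [← NNReal.tendsto_coe]
      simp only [coe_empiricalMeasure_apply, hν]
      refine (tendsto_add_atTop_iff_nat (f := fun J : ℕ => (J : ℝ)⁻¹ * ∑ j ∈ Finset.range J,
        ((C ×ˢ Set.Ico a b) ×ˢ {k}).indicator (1 : ((ℝ × ℝ) × ℝ) × σ → ℝ) (q j)) 1).2 ?_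
      have hinter : ∀ j, ((C ×ˢ Set.Ico a b) ×ˢ {k}).indicator (1 : ((ℝ × ℝ) × ℝ) × σ → ℝ) (q j) =
          (((C ∩ Set.Ico 0 1 ×ˢ Set.Ico 0 1) ×ˢ Set.Ico (a ⊔ 0) (b ⊓ 1)) ×ˢ {k}).indicator 1
            (q j) := by
        intro j
        have hqj : (q j).1.1 ∈ Set.Ico (0 : ℝ) 1 ×ˢ Set.Ico (0 : ℝ) 1 := (hq j).1
        have hqz : (q j).1.2 ∈ Set.Ico (0 : ℝ) 1 := (hq j).2
        have hiff : q j ∈ (C ×ˢ Set.Ico a b) ×ˢ {k} ↔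
            q j ∈ ((C ∩ Set.Ico 0 1 ×ˢ Set.Ico 0 1) ×ˢ Set.Ico (a ⊔ 0) (b ⊓ 1)) ×ˢ {k} := by
          rw [← Set.Ico_inter_Ico]
          simp only [Set.mem_prod (p := q j), Set.mem_prod (p := (q j).1),
            Set.mem_inter_iff (x := (q j).1.1), Set.mem_inter_iff (x := (q j).1.2), hqj, hqz,
            and_true]
        by_cases hj : q j ∈ (C ×ˢ Set.Ico a b) ×ˢ {k}
        · rw [Set.indicator_of_mem hj, Set.indicator_of_mem (hiff.1 hj)]
        · rw [Set.indicator_of_notMem hj, Set.indicator_of_notMem (fun h' => hj (hiff.2 h'))]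
      simp only [hinter]
      have hset : (C ×ˢ Set.Ico a b) ∩ unitCube =
          (C ∩ Set.Ico 0 1 ×ˢ Set.Ico 0 1) ×ˢ Set.Ico (a ⊔ 0) (b ⊓ 1) := by
        rw [unitCube, Set.prod_inter_prod, Set.Ico_inter_Ico]
      rw [hset]
      rcases le_total (a ⊔ 0) (b ⊓ 1) with hle | hle
      · have := h (C ∩ Set.Ico 0 1 ×ˢ Set.Ico 0 1) k (a ⊔ 0) (b ⊓ 1)
          (hC.inter ((convex_Ico _ _).prod (convex_Ico _ _)))
          (hCm.inter (measurableSet_Ico.prod measurableSet_Ico)) Set.inter_subset_right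
          le_sup_right hle inf_le_right
        convert this using 2
        rw [Measure.volume_eq_prod, measureReal_prod_prod, Real.volume_real_Ico_of_le hle]
        ring
      · rw [Set.Ico_eq_empty_of_le hle]
        simp
  -- As σ is discrete, the frontier lies over that of the convex set S, which is null. Measurability
  -- of S is not needed.
  have hfr : ν (frontier (S ×ˢ {i})) = 0 := by
    rw [frontier_prod_eq, (isClopen_discrete {i}).frontier_eq, Set.prod_empty, Set.empty_union,
      (isClosed_discrete {i}).closure_eq, ← NNReal.coe_eq_zero, hν]
    have hhaar : (volume : Measure ((ℝ × ℝ) × ℝ)).IsAddHaarMeasure := by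
      have h2 : (volume : Measure (ℝ × ℝ)).IsAddHaarMeasure :=
        inferInstanceAs ((volume : Measure ℝ).prod volume).IsAddHaarMeasure
      exact inferInstanceAs ((volume : Measure (ℝ × ℝ)).prod (volume : Measure ℝ)).IsAddHaarMeasure
    have h0 : volume.real (frontier S ∩ unitCube) = 0 := by
      rw [measureReal_def, measure_mono_null Set.inter_subset_left (hS.addHaar_frontier volume)]
      simp
    rw [h0, zero_div]
  have hfin := ProbabilityMeasure.tendsto_measure_of_null_frontier_of_tendsto hlim hfr
  rw [← NNReal.tendsto_coe] at hfin
  simp only [coe_empiricalMeasure_apply, hν, Set.inter_eq_left.2 hSQ] at hfin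
  exact (tendsto_add_atTop_iff_nat (f := fun J : ℕ => (J : ℝ)⁻¹ * ∑ j ∈ Finset.range J,
    (S ×ˢ {i}).indicator (1 : ((ℝ × ℝ) × ℝ) × σ → ℝ) (q j)) 1).1 hfin

/-! ### The equivalence -/

/-- Equality would read n₁v₁ + n₂v₂ = rkw + l with l an integer, a rational relation whose
coefficient rk at w is nonzero. -/
theorem planeChar_ne_fourier_pow {v : ℝ × ℝ} {w : ℝ} (hw : IsKroneckerVector₃ v w) {k : ℤ}
    (hk : k ≠ 0) {r : ℕ} (hr : 1 ≤ r) (n : ℤ × ℤ) :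
    planeChar n v ≠ fourier k (w : UnitAddCircle) ^ r := by
  intro h
  rw [fourier_coe_apply, ← Complex.exp_nat_mul, planeChar, Complex.exp_eq_exp_iff_exists_int] at h
  obtain ⟨l, hl⟩ := h
  have h2 : (2 * Real.pi * Complex.I : ℂ) ≠ 0 := Complex.two_pi_I_ne_zero
  have hl' : ((n.1 * v.1 + n.2 * v.2 : ℝ) : ℂ) = ((r * k * w + l : ℝ) : ℂ) := by
    apply mul_left_cancel₀ h2
    push_cast
    rw [hl]
    push_cast
    ring
  have hreal : n.1 * v.1 + n.2 * v.2 = r * k * w + l := by exact_mod_cast hl'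
  have hlin := Fintype.linearIndependent_iff.1 hw
    ![(n.1 : ℚ), (n.2 : ℚ), -((r : ℚ) * k), -(l : ℚ)] (by
      simp [Fin.sum_univ_four, Rat.smul_def]
      linarith) 2
  have h0 : (r : ℚ) * k = 0 := by simpa using hlin
  rcases mul_eq_zero.1 h0 with h | h
  · have : r = 0 := by exact_mod_cast h
    omega
  · exact hk (by exact_mod_cast h)

/-- The rational span of v₁, v₂, 1 is countable, and any w outside it works. -/
theorem exists_isKroneckerVector₃ {v : ℝ × ℝ} (hv : IsKroneckerVector₂ v) :
    ∃ w, IsKroneckerVector₃ v w := by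
  have hcount : (Set.range fun q : ℚ × ℚ × ℚ =>
      (q.1 : ℝ) * v.1 + (q.2.1 : ℝ) * v.2 + (q.2.2 : ℝ)).Countable := Set.countable_range _
  obtain ⟨w, hw⟩ : ∃ w : ℝ, w ∉ Set.range fun q : ℚ × ℚ × ℚ =>
      (q.1 : ℝ) * v.1 + (q.2.1 : ℝ) * v.2 + (q.2.2 : ℝ) := by
    by_contra! hall
    exact Set.not_countable_univ (hcount.mono fun x _ => hall x)
  refine ⟨w, Fintype.linearIndependent_iff.2 fun g hg => ?_⟩
  simp only [Fin.sum_univ_four, Matrix.cons_val_zero, Matrix.cons_val_one, Matrix.cons_val,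
    Rat.smul_def, mul_one] at hg
  have h2 : g 2 = 0 := by
    by_contra hne
    have hne' : (g 2 : ℝ) ≠ 0 := by exact_mod_cast hne
    refine hw ⟨(-g 0 / g 2, -g 1 / g 2, -g 3 / g 2), ?_⟩
    push_cast
    field_simp
    linarith
  rw [h2, Rat.cast_zero, zero_mul, add_zero] at hg
  have h3 := Fintype.linearIndependent_iff.1 hv ![g 0, g 1, g 3] (by
    simp [Fin.sum_univ_three, Rat.smul_def]
    linarith)
  intro i
  fin_cases i
  · exact h3 0
  · exact h3 1
  · exact h2
  · exact h3 2

theorem fourier_coe_fract_add_mul (k : ℤ) (x w : ℝ) (j : ℕ) :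
    fourier k ((Int.fract (x + j * w) : ℝ) : UnitAddCircle) =
      fourier k (x : UnitAddCircle) * fourier k (w : UnitAddCircle) ^ j := by
  rw [coe_fract_unitAddCircle, fourier_coe_apply, fourier_coe_apply, fourier_coe_apply,
    ← Complex.exp_nat_mul, ← Complex.exp_add]
  congr 1
  push_cast
  ring

theorem card_filter_div_eq_average {Ω : Type*} (q : ℕ → Ω) (p : ℕ → Prop) [DecidablePred p] (E : Set Ω)
    (h : ∀ j, p j ↔ q j ∈ E) (J : ℕ) :
    (((Finset.range J).filter p).card : ℝ) / J =
      (J : ℝ)⁻¹ * ∑ j ∈ Finset.range J, E.indicator 1 (q j) := by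
  rw [div_eq_inv_mul, Finset.card_filter]
  push_cast
  congr 1
  refine Finset.sum_congr rfl fun j _ => ?_
  by_cases hj : p j
  · rw [if_pos hj, Set.indicator_of_mem ((h j).1 hj), Pi.one_apply]
  · rw [if_neg hj, Set.indicator_of_notMem (fun h' => hj ((h j).2 h'))]

namespace PolysquareSurface

variable {σ : Type*} {P : PolysquareSurface σ}

theorem IsProductGeodesic.isGeodesic {v : ℝ × ℝ} {w : ℝ} {L : ℝ≥0 → P.ProductPoint}
    (hL : P.IsProductGeodesic v w L) : P.IsGeodesic v fun t => (L t).1 :=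
  ⟨hL.1, fun t => (hL.2 t).mono fun _ hs => congrArg Prod.fst hs⟩

theorem IsProductGeodesic.height_eq {v : ℝ × ℝ} {w : ℝ} {L : ℝ≥0 → P.ProductPoint}
    (hL : P.IsProductGeodesic v w L) (s t : ℝ≥0) :
    ((L s).2 : ℝ) = Int.fract ((L t).2 + ((s : ℝ) - t) * w) :=
  congrArg Subtype.val (eq_unitFract_of_eventually (x := fun t => (L t).2)
    (fun t => (hL.2 t).mono fun s hs => by rw [hs]) s t)

theorem coords_mem (p : P.Point) : (coords p).1 ∈ Set.Ico (0 : ℝ) 1 ×ˢ Set.Ico (0 : ℝ) 1 :=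
  ⟨p.2.1.2, p.2.2.2⟩

theorem UniformlyDistributed.tendsto_average [Fintype σ] {a : ℕ → P.Point}
    (ha : P.UniformlyDistributed a) {C : Set (ℝ × ℝ)} (i : σ) (hC : Convex ℝ C)
    (hQ : C ⊆ Set.Ico 0 1 ×ˢ Set.Ico 0 1) :
    Tendsto (fun J : ℕ => (J : ℂ)⁻¹ * ∑ j ∈ Finset.range J,
      (C ×ˢ {i}).indicator (1 : (ℝ × ℝ) × σ → ℂ) (coords (a j))) atTop
      (𝓝 ((volume.real C / Fintype.card σ : ℝ) : ℂ)) := by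
  classical
  have h := (Complex.continuous_ofReal.tendsto _).comp (ha i C hC hQ)
  refine h.congr fun J => ?_
  rw [Function.comp_apply, card_filter_div_eq_average (fun j => coords (a j))
    (fun j => (a j).1 = i ∧ (((a j).2.1 : ℝ), ((a j).2.2 : ℝ)) ∈ C) (C ×ˢ {i})
    (fun j => and_comm)]
  push_cast
  congr 1
  refine Finset.sum_congr rfl fun j _ => ?_
  by_cases hj : coords (a j) ∈ C ×ˢ {i} <;> simp [hj]

/-- The exponential sums along a Kronecker sequence in the product that stays over an equidistributed
sequence. -/
theorem IsProductGeodesic.tendsto_fourier_average [Fintype σ] {v : ℝ × ℝ}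
    (hv : IsKroneckerVector₂ v) {w : ℝ} (hw : IsKroneckerVector₃ v w) {L : ℝ≥0 → P.ProductPoint}
    (hL : P.IsProductGeodesic v w L) (hud : P.UniformlyDistributed fun j : ℕ => (L j).1)
    {C : Set (ℝ × ℝ)} (i : σ) (hC : Convex ℝ C) (hCm : MeasurableSet C)
    (hQ : C ⊆ Set.Ico 0 1 ×ˢ Set.Ico 0 1) {k : ℤ} (hk : k ≠ 0) :
    Tendsto (fun J : ℕ => (J : ℂ)⁻¹ * ∑ j ∈ Finset.range J,
      (C ×ˢ {i}).indicator (1 : (ℝ × ℝ) × σ → ℂ) (coords (L j).1) *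
        fourier k (((L j).2 : ℝ) : UnitAddCircle)) atTop (𝓝 0) := by
  let : MeasurableSpace σ := ⊤
  have : DiscreteMeasurableSpace σ := ⟨fun _ => trivial⟩
  have hind : ∀ (D : Set ((ℝ × ℝ) × σ)) p, ‖D.indicator (1 : (ℝ × ℝ) × σ → ℂ) p‖ ≤ 1 := by
    intro D p
    by_cases hp : p ∈ D <;> simp [hp]
  have hfn : ∀ x : UnitAddCircle, ‖fourier k x‖ = 1 := fun x => by
    rw [fourier_apply, Circle.norm_coe]
  obtain ⟨n, hn⟩ := exists_nat_forall_not_vertex hv hL.isGeodesic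
  have hv1 : v.1 ≠ 0 := by simpa using hv.ne_zero 0
  have hv2 : v.2 ≠ 0 := by simpa using hv.ne_zero 1
  obtain ⟨N, hN⟩ := exists_nat_gt (max |v.1| |v.2|)
  have hNpos : (0 : ℝ) < N := (abs_nonneg v.1).trans_lt ((le_max_left _ _).trans_lt hN)
  have hN0 : N ≠ 0 := by
    rintro rfl
    simp at hNpos
  have hs : ∀ y : ℝ, |y| ≤ max |v.1| |v.2| → |(N : ℝ)⁻¹ * y| < 1 := by
    intro y hy
    rw [abs_mul, abs_inv, Nat.abs_cast, inv_mul_lt_iff₀ hNpos, mul_one]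
    exact hy.trans_lt hN
  have hs1 := hs v.1 (le_max_left _ _)
  have hs2 := hs v.2 (le_max_right _ _)
  rw [← tendsto_average_shift_iff _ (fun j => by
    rw [norm_mul, hfn, mul_one]; exact hind _ _) n]
  have key := P.tendsto_twisted_average_zero hN0 hs1 hs2 (fourier k (w : UnitAddCircle)) (hfn _)
    (fun r hr m => planeChar_ne_fourier_pow hw hk hr m)
    (fun j => coords (L ((j + n : ℕ) : ℝ≥0)).1) (fun j => coords_mem _)
    (fun j => by
      have := hL.isGeodesic.coords_add_one_eq_iterate hv1 hv2 hN0 hs1 hs2 ((j + n : ℕ) : ℝ≥0)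
        (fun s hs => hn s (le_trans (by push_cast; exact le_add_self) hs))
      rw [← this]
      congr 3
      push_cast
      ring)
    (fun D l hD hDm hDQ => by
      rw [tendsto_average_shift_iff (fun j => (D ×ˢ {l}).indicator (1 : (ℝ × ℝ) × σ → ℂ)
        (coords (L (j : ℝ≥0)).1)) (fun j => hind _ _) n]
      exact hud.tendsto_average l hD hDQ)
    (indicator_mem_convexStepFunctions i hC hCm hQ) (hind _)
  -- The character at the height of time j + n is its value at time n times e(kw)^j.
  have key2 := key.const_mul (fourier k (((L n).2 : ℝ) : UnitAddCircle))
  rw [mul_zero] at key2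
  refine key2.congr fun J => ?_
  rw [mul_left_comm, Finset.mul_sum]
  congr 1
  refine Finset.sum_congr rfl fun j _ => ?_
  have hz := hL.height_eq ((j + n : ℕ) : ℝ≥0) n
  have hsub : (((j + n : ℕ) : ℝ≥0) : ℝ) - ((n : ℝ≥0) : ℝ) = j := by push_cast; ring
  rw [hz, hsub, fourier_coe_fract_add_mul]
  ring

/-- Weyl's criterion in the height, weighted by visits to C: frequency k = 0 is the hypothesis on
the projection, k ≠ 0 the exponential sum. This yields the products C × [α,β), hence all convex
sets. -/
theorem IsProductGeodesic.productUniformlyDistributed [Fintype σ] {v : ℝ × ℝ}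
    (hv : IsKroneckerVector₂ v) {w : ℝ} (hw : IsKroneckerVector₃ v w) {L : ℝ≥0 → P.ProductPoint}
    (hL : P.IsProductGeodesic v w L) (hud : P.UniformlyDistributed fun j : ℕ => (L j).1) :
    P.ProductUniformlyDistributed fun j : ℕ => L j := by
  classical
  intro i S hS hSQ
  have : Nonempty σ := ⟨i⟩
  have hcard : (1 : ℝ) ≤ Fintype.card σ := by exact_mod_cast Fintype.card_pos
  let q : ℕ → ((ℝ × ℝ) × ℝ) × σ := fun j =>
    (((coords (L j).1).1, ((L j).2 : ℝ)), (coords (L j).1).2)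
  have key := tendsto_average_indicator_convex q (fun j => ⟨coords_mem _, (L j).2.2⟩) ?_ hS hSQ i
  · have hq : ∀ j : ℕ, ((L j).1.1 = i ∧
        ((((L j).1.2.1 : ℝ), ((L j).1.2.2 : ℝ)), ((L j).2 : ℝ)) ∈ S) ↔ q j ∈ S ×ˢ {i} :=
      fun j => and_comm
    refine key.congr fun J => ?_
    rw [← card_filter_div_eq_average q _ _ hq]
  · intro C l α β hC hCm hCQ hα hαβ hβ
    have hvol : volume.real C ≤ 1 := by
      refine (measureReal_mono hCQ (by simp [Measure.volume_eq_prod, Measure.prod_prod])).trans ?_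
      rw [Measure.volume_eq_prod, measureReal_prod_prod]
      simp
    let g : ℕ → ℝ := fun j => (C ×ˢ {l}).indicator 1 (coords (L j).1)
    have hgC : ∀ j, (g j : ℂ) =
        (C ×ˢ {l}).indicator (1 : (ℝ × ℝ) × σ → ℂ) (coords (L j).1) := by
      intro j
      by_cases hj : coords (L (j : ℝ≥0)).1 ∈ C ×ˢ {l} <;> simp [g, hj]
    have h := tendsto_weighted_average_Ico (fun j => ((L j).2 : ℝ)) (fun j => (L j).2.2) g
      (fun j => Set.indicator_nonneg (fun _ _ => zero_le_one) _)
      (fun j => Set.indicator_le_self' (fun _ _ => zero_le_one) _)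
      (volume.real C / Fintype.card σ) (by positivity)
      (div_le_one_of_le₀ (hvol.trans hcard) (by positivity))
      (fun k => by
        simp only [hgC]
        split_ifs with hk
        · subst hk
          simpa using hud.tendsto_average l hC hCQ
        · exact hL.tendsto_fourier_average hv hw hud l hC hCm hCQ hk)
      hα hαβ hβ
    refine h.congr fun J => ?_
    congr 1
    refine Finset.sum_congr rfl fun j _ => ?_
    by_cases h1 : coords (L (j : ℝ≥0)).1 ∈ C ×ˢ {l}
    · by_cases h2 : ((L (j : ℝ≥0)).2 : ℝ) ∈ Set.Ico α β
      · have h3 : q j ∈ (C ×ˢ Set.Ico α β) ×ˢ {l} := ⟨⟨h1.1, h2⟩, h1.2⟩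
        simp only [g]
        rw [Set.indicator_of_mem h1, Set.indicator_of_mem h2, Set.indicator_of_mem h3]
        simp
      · have h3 : q j ∉ (C ×ˢ Set.Ico α β) ×ˢ {l} := fun h => h2 h.1.2
        rw [Set.indicator_of_notMem h2, Set.indicator_of_notMem h3, mul_zero]
    · have h3 : q j ∉ (C ×ˢ Set.Ico α β) ×ˢ {l} := fun h => h1 ⟨h.1.1, h.2⟩
      simp only [g]
      rw [Set.indicator_of_notMem h1, Set.indicator_of_notMem h3, zero_mul]

theorem IsGeodesic.isProductGeodesic {v : ℝ × ℝ} {L : ℝ≥0 → P.Point} (hL : P.IsGeodesic v L)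
    (w : ℝ) : P.IsProductGeodesic v w fun t => (L t, unitFract (t * w)) := by
  refine ⟨hL.1, fun t => (hL.2 t).mono fun s hs => Prod.ext hs (Subtype.ext ?_)⟩
  simp only [unitFract]
  rw [Int.fract_eq_fract]
  -- The two heights differ by tw minus its fractional part.
  refine ⟨⌊(t : ℝ) * w⌋, ?_⟩
  rw [← Int.self_sub_floor]
  ring

theorem ProductUniformlyDistributed.uniformlyDistributed [Fintype σ] {a : ℕ → P.ProductPoint}
    (ha : P.ProductUniformlyDistributed a) : P.UniformlyDistributed fun j => (a j).1 := by
  intro i S hS hSQ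
  have h := ha i (S ×ˢ Set.Ico 0 1) (hS.prod (convex_Ico 0 1)) (Set.prod_mono hSQ subset_rfl)
  have hvol : volume.real (S ×ˢ Set.Ico (0 : ℝ) 1) = volume.real S := by
    rw [Measure.volume_eq_prod, measureReal_prod_prod]
    simp
  rw [hvol] at h
  refine h.congr fun J => ?_
  congr! 4 with j
  exact and_congr_right fun _ => and_iff_left (a j).2.2

end PolysquareSurface

theorem theorem4 {σ : Type*} [Fintype σ] (P : PolysquareSurface σ)
    (v : ℝ × ℝ) (hv : IsKroneckerVector₂ v) :
    (∀ a : ℕ → P.Point, P.IsStepSequence v a → P.UniformlyDistributed a) ↔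
      ∀ w : ℝ, IsKroneckerVector₃ v w →
        ∀ a : ℕ → P.ProductPoint, P.IsProductStepSequence v w a →
          P.ProductUniformlyDistributed a := by
  constructor
  · rintro h w hw a ⟨L, hL, ha⟩
    obtain rfl : a = fun j : ℕ => L j := funext ha
    exact hL.productUniformlyDistributed hv hw
      (h _ ⟨fun t => (L t).1, hL.isGeodesic, fun _ => rfl⟩)
  · rintro h a ⟨L, hL, ha⟩
    obtain rfl : a = fun j : ℕ => L j := funext ha
    obtain ⟨w, hw⟩ := exists_isKroneckerVector₃ hv
    exact (h w hw _ ⟨_, hL.isProductGeodesic w, fun _ => rfl⟩).uniformlyDistributed
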